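/- Let $\mu$ be a finite positive Borel measure on the bicircle $\mathbb T^2=\{(e^{i\theta},e^{i\phi})\}$, and let $n,m\ge 0$. Write $z=e^{i\theta}$, $w=e^{i\phi}$, $\mathcal L(f)=\frac1{(2\pi)^2}\int f\,d\mu$ and $\langle p,q\rangle=\mathcal L(p\,\overline q)$, applied entrywise to vectors as $\langle X,Y\rangle=\mathcal L(XY^\dagger)$. Call $\mathcal L$ positive definite if $\mathcal L(|p|^2)>0$ for every nonzero polynomial $p(z,w)$. When $\mathcal L$ is positive definite, define for $0\le l\le j$ the polynomial $\phi^l_{i,j}$, with positive coefficient of $z^iw^l$, by applying the Gram–Schmidt procedure (orthonormalization with respect to $\langle\cdot,\cdot\rangle$) to the monomials $z^aw^b$, $a\ge0$, $0\le b\le j$, in the lexicographical order ($z^aw^b$ before $z^{a'}w^{b'}$ if $a<a'$, or $a=a'$ and $b<b'$); $\phi^l_{i,j}$ is the element with leading monomial $z^iw^l$. Define $\tilde\phi^l_{i,j}$, $0\le l\le i$, with leading monomial $z^lw^j$, in the same way from the monomials $z^aw^b$, $0\le a\le i$, $b\ge 0$, in the reverse lexicographical order (the roles of the two exponents interchanged).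 Put $\Phi_{i,j}=(\phi^j_{i,j},\phi^{j-1}_{i,j},\dots,\phi^0_{i,j})^T$ and $\tilde\Phi_{i,j}=(\tilde\phi^i_{i,j},\dots,\tilde\phi^0_{i,j})^T$. The reverse of a polynomial $p$ of degree at most $i$ in $z$ and at most $j$ in $w$ is $\overleftarrow p(z,w)=z^iw^j\,\overline{p(1/\bar z,1/\bar w)}$; let $\overleftarrow\Phi{}^T_{i,j}$ and $\overleftarrow{\tilde\Phi}{}^T_{i,j}$ be the column vectors of the reverses (at level $(i,j)$) of the entries of $\Phi_{i,j}$ and $\tilde\Phi_{i,j}$. Define the coefficient matrices $$\mathcal K_{i,j}=\langle\Phi_{i,j-1},\tilde\Phi_{i-1,j}\rangle\in\mathbb C^{j\times i},\qquad \hat E_{i+1,j}=\langle z\Phi_{i,j},\overleftarrow\Phi{}^T_{i,j}\rangle,\qquad \hat{\tilde E}_{i,j+1}=\langle w\tilde\Phi_{i,j},\overleftarrow{\tilde\Phi}{}^T_{i,j}\rangle$$ ($\mathcal K_{i,j}$ is empty, hence zero, if $i=0$ or $j=0$). Then the following are equivalent. (a) $\mu$ is absolutely continuous with respect to Lebesgue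 measure $d\theta\,d\phi$ and $$d\mu(\theta,\phi)=\frac{1}{|p_{n,m}(e^{i\theta},e^{i\phi})|^2}\,d\theta\,d\phi$$ for some polynomial $p_{n,m}(z,w)=\sum_{a=0}^n\sum_{b=0}^m k_{a,b}z^aw^b$ with $k_{n,m}\ne0$ whose reverse $\overleftarrow p_{n,m}(z,w)=z^nw^m\,\overline{p_{n,m}(1/\bar z,1/\bar w)}$ is stable, i.e. has no zero with $|z|\le1$, $|w|\le1$. (b) $\mathcal L$ is positive definite (so that the coefficients above are defined), and for all $i\ge n$, $j\ge m$ $$\mathcal K_{i,j}=0,\qquad \hat E_{i+1,j}=0,\qquad \hat{\tilde E}_{n,j+1}=0 .$$ -/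

import Mathlib

open MeasureTheory

namespace BiCircle

instance factTwoPiPos : Fact ((0 : ℝ) < 2 * Real.pi) := ⟨Real.two_pi_pos⟩

/-- The bicircle, parametrized by the angles `(θ, φ)` modulo `2π`. Its `volume` is `dθ dφ`,
of total mass `(2π)²`. -/
abbrev Torus : Type := AddCircle (2 * Real.pi) × AddCircle (2 * Real.pi)

/-- Complex polynomials in two variables; `X 0` is `z` and `X 1` is `w`. -/
abbrev Poly : Type := MvPolynomial (Fin 2) ℂ

noncomputable section

/-- The value `p(z, w)`. -/
def evalAt (p : Poly) (z w : ℂ) : ℂ := MvPolynomial.eval ![z, w] p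

/-- The value `p(e^{iθ}, e^{iφ})` at the point `x = (θ, φ)` of the bicircle. -/
def onTorus (p : Poly) (x : Torus) : ℂ :=
  evalAt p (AddCircle.toCircle x.1 : ℂ) (AddCircle.toCircle x.2 : ℂ)

/-- The monomial `z^a w^b`. -/
def mono (a b : ℕ) : Poly := MvPolynomial.X 0 ^ a * MvPolynomial.X 1 ^ b

/-- The coefficient of `z^a w^b` in `p`. -/
def coeffAt (p : Poly) (a b : ℕ) : ℂ :=
  MvPolynomial.coeff (Finsupp.single 0 a + Finsupp.single 1 b) p

/-- `p = ∑_{a ≤ n, b ≤ m} k_{a,b} z^a w^b` with `k_{n,m} ≠ 0`. -/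
def HasBidegree (n m : ℕ) (p : Poly) : Prop :=
  p.degreeOf 0 ≤ n ∧ p.degreeOf 1 ≤ m ∧ coeffAt p n m ≠ 0

/-- The reverse `z^n w^m p̄(1/z, 1/w)` of a polynomial `p` of degree at most `n` in `z` and at
most `m` in `w`, where `p̄` has the conjugate coefficients. -/
def reverse (n m : ℕ) (p : Poly) : Poly :=
  ∑ a ∈ Finset.range (n + 1), ∑ b ∈ Finset.range (m + 1),
    MvPolynomial.C (starRingEnd ℂ (coeffAt p (n - a) (m - b))) * mono a b

/-- `p` has no zero in the closed bidisk. -/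
def IsStable (p : Poly) : Prop :=
  ∀ z w : ℂ, ‖z‖ ≤ 1 → ‖w‖ ≤ 1 → evalAt p z w ≠ 0

/-- `⟨p, q⟩ = ℒ(p q†)` with `ℒ(f) = (2π)⁻² ∫ f dμ`. -/
def ip (μ : Measure Torus) (p q : Poly) : ℂ :=
  (1 / (2 * (Real.pi : ℂ)) ^ 2) * ∫ x, onTorus p x * starRingEnd ℂ (onTorus q x) ∂μ

/-- The functional `ℒ` of `μ` is positive definite: `ℒ(|p|²) > 0` for all nonzero polynomials. -/
def PosDefinite (μ : Measure Torus) : Prop :=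
  ∀ p : Poly, p ≠ 0 → 0 < (1 / (2 * Real.pi) ^ 2) * ∫ x, ‖onTorus p x‖ ^ 2 ∂μ

/-- The Gram–Schmidt orthonormalization of `e 0, e 1, e 2, …`, with positive normalization:
subtract from `e k` its components along the earlier vectors, then divide by the norm. -/
def orthonormalize (μ : Measure Torus) (e : ℕ → Poly) (k : ℕ) : Poly :=
  let r : Poly := e k - ∑ j : Fin k,
    MvPolynomial.C (ip μ (e k) (orthonormalize μ e j)) * orthonormalize μ e j
  MvPolynomial.C ((1 / Real.sqrt (ip μ r r).re : ℝ) : ℂ) * r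
termination_by k
decreasing_by all_goals exact j.isLt

/-- `φ^l_{n,m}`, `l ≤ m`: the orthonormal polynomial with leading monomial `z^n w^l`. The monomials
`z^a w^b`, `b ≤ m`, are listed in the lexicographical order
`1, w, …, w^m, z, zw, …, zw^m, z^2, …`, in which `z^a w^b` has the position `a (m + 1) + b`. -/
def phi (μ : Measure Torus) (n m l : ℕ) : Poly :=
  orthonormalize μ (fun k => mono (k / (m + 1)) (k % (m + 1))) (n * (m + 1) + l)

/-- `φ̃^l_{n,m}`, `l ≤ n`: the orthonormal polynomial with leading monomial `z^l w^m`. The monomials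
`z^a w^b`, `a ≤ n`, are listed in the reverse lexicographical order
`1, z, …, z^n, w, zw, …, z^n w, w^2, …`, in which `z^a w^b` has the position `b (n + 1) + a`. -/
def phiTilde (μ : Measure Torus) (n m l : ℕ) : Poly :=
  orthonormalize μ (fun k => mono (k % (n + 1)) (k / (n + 1))) (m * (n + 1) + l)

/-- The vector `Φ_{n,m} = (φ^m_{n,m}, φ^{m-1}_{n,m}, …, φ^0_{n,m})`. -/
def Phi (μ : Measure Torus) (n m : ℕ) (s : Fin (m + 1)) : Poly := phi μ n m (m - s)

/-- The vector `Φ̃_{n,m} = (φ̃^n_{n,m}, φ̃^{n-1}_{n,m}, …, φ̃^0_{n,m})`. -/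
def PhiTilde (μ : Measure Torus) (n m : ℕ) (s : Fin (n + 1)) : Poly := phiTilde μ n m (n - s)

/-- The `m × n` matrix `𝒦_{n,m} = ⟨Φ_{n,m-1}, Φ̃_{n-1,m}⟩`; it is empty if `n = 0` or `m = 0`. -/
def calK (μ : Measure Torus) : (n m : ℕ) → Matrix (Fin m) (Fin n) ℂ
  | n + 1, m + 1 => Matrix.of fun s t => ip μ (Phi μ (n + 1) m s) (PhiTilde μ n (m + 1) t)
  | 0, _ => 0
  | _, 0 => 0

/-- The matrix `Ê_{n+1,m} = ⟨z Φ_{n,m}, (reverse of Φ_{n,m})ᵀ⟩` of size `m + 1`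
(note the shift of the first index: `EhatSucc μ n m` is `Ê_{n+1,m}`). -/
def EhatSucc (μ : Measure Torus) (n m : ℕ) : Matrix (Fin (m + 1)) (Fin (m + 1)) ℂ :=
  Matrix.of fun s t => ip μ (MvPolynomial.X 0 * Phi μ n m s) (reverse n m (Phi μ n m t))

/-- The matrix `Ẽ̂_{n,m+1} = ⟨w Φ̃_{n,m}, (reverse of Φ̃_{n,m})ᵀ⟩` of size `n + 1`
(note the shift of the second index: `EhatTildeSucc μ n m` is `Ẽ̂_{n,m+1}`). -/
def EhatTildeSucc (μ : Measure Torus) (n m : ℕ) : Matrix (Fin (n + 1)) (Fin (n + 1)) ℂ :=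
  Matrix.of fun s t =>
    ip μ (MvPolynomial.X 1 * PhiTilde μ n m s) (reverse n m (PhiTilde μ n m t))

end

end BiCircle

/-! On the bicircle the reverse `q` of `p` equals z^n w^m times the conjugate of `p`, so |q| = |p|.
Both directions rest on one equivalence: `q` has no zero in the closed bidisk iff it has none on the
bicircle and the Fourier coefficients of 1/q live in the first quadrant (`IsBiPoly.ne_zero`,
`IsBiPoly.integral_eq_zero`). The matrix conditions are first recast as orthogonality statements
(`KOrth`, `EOrth` and their mirror images).

From orthogonality to the weight: take p = φ^m_{n,m}, which is orthogonal to every monomial of its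
rectangle except the corner z^n w^m. The conditions on Ê and its tilde version keep this property
under multiplication by monomials, and 𝒦 = 0 extends the orthogonality from a rectangle to a strip.
Together they make `p` orthogonal to all z^a w^b with integer exponents and a < n or b < m
(`intL_emb_mul_star_chi`). Hence |p|² dμ has only a constant Fourier term and is Lebesgue measure.
Since μ is finite, `p` has no zero on the bicircle (`emb_ne_zero_of_withDensity`), so μ has density
1/|p|². The same orthogonality then says that 1/q has its coefficients in the first quadrant, which
gives stability.

From the weight to orthogonality: let `f` have w-degree below J ≥ m and be orthogonal to z^a w^b for
0 ≤ a < i, b < J, where i ≥ n. A Gohberg–Semencul system `dual`, biorthogonal to the characters of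
the strip and of z-degree between -n and n, shows that `f` is also orthogonal to the characters with
negative a (`intL_mul_star_eq_zero_of_neg`). This already gives the conditions on Ê. For 𝒦, the
pairings of `f` with the next row w^J are bounded and satisfy a linear recurrence with
characteristic polynomial q(z,0), which has no root in the closed disk, so they vanish
(`intL_mul_star_eq_zero_succ`). -/

namespace BiCircle

noncomputable section

/-! ### Characters and Fourier uniqueness on the bicircle -/

/-- The point `e^{it}` of the unit circle as a complex number. -/
def circ (t : AddCircle (2 * Real.pi)) : ℂ := (AddCircle.toCircle t : ℂ)

@[simp] lemma norm_circ (t : AddCircle (2 * Real.pi)) : ‖circ t‖ = 1 := Circle.norm_coe _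

@[simp] lemma circ_ne_zero (t : AddCircle (2 * Real.pi)) : circ t ≠ 0 := Circle.coe_ne_zero _

@[fun_prop] lemma continuous_circ : Continuous circ :=
  continuous_subtype_val.comp AddCircle.continuous_toCircle

lemma conj_circ (t : AddCircle (2 * Real.pi)) : starRingEnd ℂ (circ t) = (circ t)⁻¹ := by
  rw [circ, ← Circle.coe_inv_eq_conj, Circle.coe_inv]

lemma circ_injective : Function.Injective circ := fun _ _ h =>
  AddCircle.injective_toCircle Real.two_pi_pos.ne' (Subtype.coe_injective h)

lemma circ_coe (θ : ℝ) : circ (θ : AddCircle (2 * Real.pi)) = circleMap 0 1 θ := by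
  rw [circ, AddCircle.toCircle_apply_mk, Circle.coe_exp, circleMap]
  rw [div_self Real.two_pi_pos.ne', one_mul]
  simp

lemma exists_circ_eq {z : ℂ} (hz : ‖z‖ = 1) : ∃ t, circ t = z := by
  refine ⟨(Complex.arg z : ℝ), ?_⟩
  rw [circ_coe, circleMap]
  simpa [hz] using Complex.norm_mul_exp_arg_mul_I z

lemma integral_comp_circ (g : ℂ → ℂ) :
    ∫ t, g (circ t) = 2 * Real.pi * Real.circleAverage g 0 1 := by
  rw [← AddCircle.intervalIntegral_preimage (2 * Real.pi) 0 (fun t => g (circ t)),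
    Real.circleAverage_def]
  simp only [circ_coe, zero_add]
  rw [Complex.real_smul]
  push_cast
  have : (Real.pi : ℂ) ≠ 0 := by exact_mod_cast Real.pi_ne_zero
  field_simp

lemma integral_circ_zpow (a : ℤ) :
    ∫ t, circ t ^ a = if a = 0 then (2 * Real.pi : ℂ) else 0 := by
  split_ifs with h
  · subst h
    simp [Measure.real, AddCircle.measure_univ, Real.pi_pos.le]
  · rw [integral_comp_circ (fun z => z ^ a),
      Real.circleAverage_eq_circleIntegral (by norm_num)]
    have h1 : (∮ z in C(0, 1), (z - 0)⁻¹ • z ^ a) = ∮ z in C(0, 1), (z - 0) ^ (a - 1) := by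
      refine circleIntegral.integral_congr zero_le_one fun z hz => ?_
      have hz0 : z ≠ 0 := by
        rintro rfl
        simp at hz
      simp only [sub_zero, smul_eq_mul]
      rw [zpow_sub_one₀ hz0, mul_comm]
    rw [h1, circleIntegral.integral_sub_zpow_of_ne (by omega)]
    simp

/-- The character `z^a w^b` of the bicircle. -/
def chi (a b : ℤ) : C(Torus, ℂ) where
  toFun x := circ x.1 ^ a * circ x.2 ^ b
  continuous_toFun := by
    refine Continuous.mul ?_ ?_
    · exact (continuous_circ.comp continuous_fst).zpow₀ a fun x => Or.inl (circ_ne_zero _)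
    · exact (continuous_circ.comp continuous_snd).zpow₀ b fun x => Or.inl (circ_ne_zero _)

lemma chi_apply (a b : ℤ) (x : Torus) : chi a b x = circ x.1 ^ a * circ x.2 ^ b := rfl

lemma chi_zero : chi 0 0 = 1 := by ext x; simp [chi_apply]

lemma chi_mul (a b c d : ℤ) : chi a b * chi c d = chi (a + c) (b + d) := by
  ext x
  simp only [ContinuousMap.mul_apply, chi_apply, zpow_add₀ (circ_ne_zero _)]
  ring

lemma star_chi (a b : ℤ) : star (chi a b) = chi (-a) (-b) := by
  ext x
  simp [chi_apply, conj_circ]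

lemma integral_chi (a b : ℤ) :
    ∫ x, chi a b x = if a = 0 ∧ b = 0 then (2 * Real.pi : ℂ) ^ 2 else 0 := by
  simp only [chi_apply]
  rw [Measure.volume_eq_prod, integral_prod_mul (fun t => circ t ^ a) (fun t => circ t ^ b),
    integral_circ_zpow, integral_circ_zpow]
  split_ifs <;> simp_all [sq]

/-- Stone–Weierstrass. The characters are closed under products, so the algebra they generate is
already their linear span. -/
lemma span_chi_closure :
    (Submodule.span ℂ (Set.range fun ab : ℤ × ℤ => chi ab.1 ab.2)).topologicalClosure = ⊤ := by
  let A : StarSubalgebra ℂ C(Torus, ℂ) :=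
    { toSubalgebra := Algebra.adjoin ℂ (Set.range fun ab : ℤ × ℤ => chi ab.1 ab.2)
      star_mem' := by
        change Algebra.adjoin ℂ (Set.range fun ab : ℤ × ℤ => chi ab.1 ab.2) ≤
          star (Algebra.adjoin ℂ (Set.range fun ab : ℤ × ℤ => chi ab.1 ab.2))
        refine Algebra.adjoin_le ?_
        rintro _ ⟨ab, rfl⟩
        exact Algebra.subset_adjoin ⟨(-ab.1, -ab.2), (star_chi _ _).symm⟩ }
  have hA : A.SeparatesPoints := by
    intro x y hxy
    have key : ∀ a b, chi a b ∈ A := fun a b => Algebra.subset_adjoin ⟨(a, b), rfl⟩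
    by_contra! hcon
    apply hxy
    refine Prod.ext (circ_injective ?_) (circ_injective ?_)
    · simpa [chi_apply] using hcon _ ⟨chi 1 0, key 1 0, rfl⟩
    · simpa [chi_apply] using hcon _ ⟨chi 0 1, key 0 1, rfl⟩
  have h1 := ContinuousMap.starSubalgebra_topologicalClosure_eq_top_of_separatesPoints A hA
  have h2 : Subalgebra.toSubmodule A.toSubalgebra =
      Submodule.span ℂ (Set.range fun ab : ℤ × ℤ => chi ab.1 ab.2) := by
    apply Algebra.adjoin_eq_span_of_subset
    refine Set.Subset.trans ?_ Submodule.subset_span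
    intro x hx
    refine Submonoid.closure_induction (fun _ => id) ⟨0, chi_zero⟩ ?_ hx
    rintro - - - - ⟨m, rfl⟩ ⟨n, rfl⟩
    exact ⟨m + n, (chi_mul _ _ _ _).symm⟩
  rw [← h2]
  exact congr_arg (Subalgebra.toSubmodule <| StarSubalgebra.toSubalgebra ·) h1

/-- Integration against a finite measure, as a continuous functional. -/
def intL (μ : Measure Torus) [IsFiniteMeasure μ] : C(Torus, ℂ) →L[ℂ] ℂ :=
  LinearMap.mkContinuous
    { toFun := fun F => ∫ x, F x ∂μ
      map_add' := fun F G => integral_add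
        (F.continuous.integrable_of_hasCompactSupport (HasCompactSupport.of_compactSpace _))
        (G.continuous.integrable_of_hasCompactSupport (HasCompactSupport.of_compactSpace _))
      map_smul' := fun c F => integral_smul c _ }
    (μ.real Set.univ) fun F => by
      exact (norm_integral_le_of_norm_le_const
        (Filter.Eventually.of_forall F.norm_coe_le_norm)).trans_eq (mul_comm _ _)

lemma intL_apply (μ : Measure Torus) [IsFiniteMeasure μ] (F : C(Torus, ℂ)) :
    intL μ F = ∫ x, F x ∂μ := rfl

lemma eq_of_eq_on_chi {L L' : C(Torus, ℂ) →L[ℂ] ℂ} (h : ∀ a b, L (chi a b) = L' (chi a b)) :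
    L = L' := by
  refine ContinuousLinearMap.ext_on
    (s := Set.range fun ab : ℤ × ℤ => chi ab.1 ab.2) ?_ ?_
  · rw [Submodule.dense_iff_topologicalClosure_eq_top]
    exact span_chi_closure
  · rintro _ ⟨ab, rfl⟩
    exact h _ _

lemma measure_ext_of_chi {μ ν : Measure Torus} [IsFiniteMeasure μ] [IsFiniteMeasure ν]
    (h : ∀ a b, ∫ x, chi a b x ∂μ = ∫ x, chi a b x ∂ν) : μ = ν := by
  have hL : intL μ = intL ν := eq_of_eq_on_chi h
  refine ext_of_forall_integral_eq_of_IsFiniteMeasure fun f => ?_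
  let F : C(Torus, ℂ) := ⟨fun x => (f x : ℂ), by fun_prop⟩
  have := DFunLike.congr_fun hL F
  simp only [intL_apply, F, ContinuousMap.coe_mk] at this
  rw [integral_complex_ofReal, integral_complex_ofReal] at this
  exact_mod_cast this

/-- A polynomial as a continuous function on the bicircle. -/
def emb : Poly →ₐ[ℂ] C(Torus, ℂ) := MvPolynomial.aeval ![chi 1 0, chi 0 1]

lemma emb_apply (p : Poly) (x : Torus) : emb p x = onTorus p x := by
  rw [onTorus, evalAt, emb]
  induction p using MvPolynomial.induction_on with
  | C a => simp [Algebra.algebraMap_eq_smul_one]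
  | add p q hp hq => simp [hp, hq]
  | mul_X p i hp =>
    rw [map_mul, map_mul, ContinuousMap.mul_apply, hp]
    congr 1
    fin_cases i <;> simp [chi_apply, circ]

lemma emb_X0 : emb (MvPolynomial.X 0) = chi 1 0 := by simp [emb]

lemma emb_X1 : emb (MvPolynomial.X 1) = chi 0 1 := by simp [emb]

lemma chi_pow (a b : ℤ) (k : ℕ) : chi a b ^ k = chi (k * a) (k * b) := by
  induction k with
  | zero => simp [chi_zero]
  | succ k ih =>
    rw [pow_succ, ih, chi_mul]
    congr 1 <;> push_cast <;> ring

lemma emb_mono (a b : ℕ) : emb (mono a b) = chi a b := by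
  rw [mono, map_mul, map_pow, map_pow, emb_X0, emb_X1, chi_pow, chi_pow, chi_mul]
  simp

/-! ### Zeros in the disk and one-sided Fourier series, one variable -/

lemma integral_circ_div_sub {f : ℂ → ℂ} (hf : DiffContOnCl ℂ f (Metric.ball 0 1)) {α : ℂ}
    (hα : ‖α‖ < 1) :
    ∫ t, circ t / (circ t - α) * f (circ t) = 2 * Real.pi * f α := by
  rw [integral_comp_circ (fun z => z / (z - α) * f z)]
  have h := DiffContOnCl.circleAverage_smul_div (c := 0) (R := 1) (w := α) (f := f)
    (by simpa using hf) (by simpa using hα)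
  simp only [sub_zero, smul_eq_mul] at h
  rw [h]

lemma integral_circ_pow_mul {f : ℂ → ℂ} (hf : DiffContOnCl ℂ f (Metric.ball 0 1)) {a : ℕ}
    (ha : 1 ≤ a) : ∫ t, circ t ^ a * f (circ t) = 0 := by
  have h := integral_circ_div_sub (f := fun z => z ^ a * f z) (α := 0)
    (DiffContOnCl.smul (𝕜 := ℂ) (c := fun z => z ^ a)
      (Differentiable.diffContOnCl (by fun_prop)) hf) (by simp)
  simpa [show a ≠ 0 by omega] using h

lemma diffContOnCl_inv_polynomial {Q : Polynomial ℂ} (hQ : ∀ z, ‖z‖ ≤ 1 → Q.eval z ≠ 0) :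
    DiffContOnCl ℂ (fun z => (Q.eval z)⁻¹) (Metric.ball 0 1) := by
  refine DiffContOnCl.inv Q.differentiable.diffContOnCl fun z hz => hQ z ?_
  rw [closure_ball _ one_ne_zero] at hz
  simpa using hz

/-- A zero α would give Q = (z - α) R. Then z R / Q = z / (z - α) has integral 2π by Cauchy's
formula, although it is a combination of the vanishing moments of 1/Q. -/
lemma polynomial_eval_ne_zero_of_integral {Q : Polynomial ℂ} (hQ : ∀ t, Q.eval (circ t) ≠ 0)
    (h : ∀ a : ℕ, 1 ≤ a → ∫ t, circ t ^ a * (Q.eval (circ t))⁻¹ = 0) {α : ℂ} (hα : ‖α‖ < 1) :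
    Q.eval α ≠ 0 := by
  intro h0
  obtain ⟨R, hR⟩ := Polynomial.dvd_iff_isRoot.mpr h0
  have hc : Continuous fun t => (Q.eval (circ t))⁻¹ :=
    (Q.continuous.comp continuous_circ).inv₀ hQ
  have h1 : ∫ t, circ t * R.eval (circ t) * (Q.eval (circ t))⁻¹ = 0 := by
    have : ∀ t, circ t * R.eval (circ t) * (Q.eval (circ t))⁻¹ =
        ∑ k ∈ Finset.range (R.natDegree + 1),
          R.coeff k * (circ t ^ (k + 1) * (Q.eval (circ t))⁻¹) := fun t => by
      rw [Polynomial.eval_eq_sum_range, Finset.mul_sum, Finset.sum_mul]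
      exact Finset.sum_congr rfl fun k _ => by ring
    simp only [this]
    rw [integral_finsetSum]
    · refine Finset.sum_eq_zero fun k _ => ?_
      rw [integral_const_mul, h _ (by omega), mul_zero]
    · intro k _
      refine Continuous.integrable_of_hasCompactSupport ?_ (HasCompactSupport.of_compactSpace _)
      fun_prop
  have h2 := integral_circ_div_sub (f := fun _ => 1) diffContOnCl_const hα
  have h3 : ∀ t, circ t * R.eval (circ t) * (Q.eval (circ t))⁻¹ = circ t / (circ t - α) * 1 := by
    intro t
    have hq := hQ t
    rw [hR] at hq ⊢
    simp only [Polynomial.eval_mul, Polynomial.eval_sub, Polynomial.eval_X,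
      Polynomial.eval_C] at hq ⊢
    have h4 := left_ne_zero_of_mul hq
    have h5 := right_ne_zero_of_mul hq
    field_simp
  simp only [h3, h2] at h1
  simp [Real.pi_ne_zero] at h1

/-- A summable Fourier series, here the zero series, converges pointwise to the continuous function
it comes from. -/
lemma eq_zero_of_integral_circ_zpow {G : AddCircle (2 * Real.pi) → ℂ} (hG : Continuous G)
    (h : ∀ b : ℤ, ∫ t, circ t ^ b * G t = 0) (t : AddCircle (2 * Real.pi)) : G t = 0 := by
  let g : C(AddCircle (2 * Real.pi), ℂ) := ⟨G, hG⟩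
  have h0 : fourierCoeff g = 0 := by
    ext n
    have : ∀ t, fourier (-n) t • g t = circ t ^ (-n) * G t := fun t => by
      rw [fourier_apply, AddCircle.toCircle_zsmul, Circle.coe_zpow]
      rfl
    rw [fourierCoeff, AddCircle.integral_haarAddCircle]
    simp only [this, h, smul_zero, Pi.zero_apply]
  have hs := has_pointwise_sum_fourier_series_of_summable (f := g)
    (by rw [h0]; exact summable_zero) t
  simp only [h0, Pi.zero_apply, zero_smul] at hs
  exact hs.unique hasSum_zero

/-! ### Stability and first-quadrant Fourier coefficients of 1/Q -/

/-- Separately polynomial functions of two variables, continuous on the bicircle. -/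
structure IsBiPoly (Q : ℂ → ℂ → ℂ) : Prop where
  left : ∀ w, ∃ P : Polynomial ℂ, ∀ z, P.eval z = Q z w
  right : ∀ z, ∃ P : Polynomial ℂ, ∀ w, P.eval w = Q z w
  cont : Continuous fun x : Torus => Q (circ x.1) (circ x.2)

lemma IsBiPoly.symm {Q : ℂ → ℂ → ℂ} (h : IsBiPoly Q) : IsBiPoly fun z w => Q w z :=
  ⟨h.right, h.left, h.cont.comp continuous_swap⟩

lemma integral_torus {f : Torus → ℂ} (hf : Continuous f) :
    ∫ x, f x = ∫ s, ∫ t, f (t, s) := by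
  rw [Measure.volume_eq_prod, integral_prod_symm]
  exact hf.integrable_of_hasCompactSupport (HasCompactSupport.of_compactSpace _)

lemma integral_torus' {f : Torus → ℂ} (hf : Continuous f) :
    ∫ x, f x = ∫ t, ∫ s, f (t, s) := by
  rw [Measure.volume_eq_prod, integral_prod]
  exact hf.integrable_of_hasCompactSupport (HasCompactSupport.of_compactSpace _)

lemma integral_torus_swap {f : Torus → ℂ} (hf : Continuous f) :
    ∫ x : Torus, f x.swap = ∫ x, f x := by
  rw [integral_torus' hf, integral_torus (f := fun x => f x.swap) (hf.comp continuous_swap)]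
  rfl

lemma IsBiPoly.continuous_chi_mul_inv {Q : ℂ → ℂ → ℂ} (hQ : IsBiPoly Q)
    (h0 : ∀ t s, Q (circ t) (circ s) ≠ 0) (a b : ℤ) :
    Continuous fun x : Torus => chi a b x * (Q (circ x.1) (circ x.2))⁻¹ :=
  (chi a b).continuous.mul (hQ.cont.inv₀ fun _ => h0 _ _)

/-- As a continuous function of `s`, the inner integral has all its Fourier coefficients zero by
Fubini; so it vanishes at every `s`, not merely almost everywhere. -/
lemma IsBiPoly.inner_integral_eq_zero {Q : ℂ → ℂ → ℂ} (hQ : IsBiPoly Q)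
    (h0 : ∀ t s, Q (circ t) (circ s) ≠ 0)
    (h : ∀ a b : ℤ, 1 ≤ a → ∫ x : Torus, chi a b x * (Q (circ x.1) (circ x.2))⁻¹ = 0)
    {a : ℕ} (ha : 1 ≤ a) (s : AddCircle (2 * Real.pi)) :
    ∫ t, circ t ^ a * (Q (circ t) (circ s))⁻¹ = 0 := by
  refine eq_zero_of_integral_circ_zpow
    (G := fun s => ∫ t, circ t ^ a * (Q (circ t) (circ s))⁻¹) ?_ (fun b => ?_) s
  · have hc : Continuous (Function.uncurry fun s t : AddCircle (2 * Real.pi) =>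
        circ t ^ a * (Q (circ t) (circ s))⁻¹) :=
      ((continuous_circ.comp continuous_snd).pow a).mul
        ((hQ.cont.comp continuous_swap).inv₀ fun _ => h0 _ _)
    have := continuous_parametric_integral_of_continuous (μ := volume) hc isCompact_univ
    simpa using this
  · have := h a b (by omega)
    rw [integral_torus (hQ.continuous_chi_mul_inv h0 a b)] at this
    rw [← this]
    congr 1
    ext s
    rw [← integral_const_mul]
    congr 1
    ext t
    simp only [chi_apply, zpow_natCast]
    ring

lemma IsBiPoly.ne_zero_left {Q : ℂ → ℂ → ℂ} (hQ : IsBiPoly Q)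
    (h0 : ∀ t s, Q (circ t) (circ s) ≠ 0)
    (h : ∀ a b : ℤ, 1 ≤ a → ∫ x : Torus, chi a b x * (Q (circ x.1) (circ x.2))⁻¹ = 0)
    {z : ℂ} (hz : ‖z‖ < 1) (s : AddCircle (2 * Real.pi)) : Q z (circ s) ≠ 0 := by
  obtain ⟨P, hP⟩ := hQ.left (circ s)
  rw [← hP]
  refine polynomial_eval_ne_zero_of_integral (fun t => by rw [hP]; exact h0 t s)
    (fun a ha => ?_) hz
  simp only [hP]
  exact hQ.inner_integral_eq_zero h0 h ha s

/-- If one variable lies on the circle, the one-variable criterion applies in the other. If both are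
interior, it is applied in w to Q(z, ·), whose reciprocal has vanishing moments because Cauchy's
formula in z expresses it through the values of 1/Q on the bicircle. -/
lemma IsBiPoly.ne_zero {Q : ℂ → ℂ → ℂ} (hQ : IsBiPoly Q)
    (h0 : ∀ t s, Q (circ t) (circ s) ≠ 0)
    (h : ∀ a b : ℤ, 1 ≤ a ∨ 1 ≤ b →
      ∫ x : Torus, chi a b x * (Q (circ x.1) (circ x.2))⁻¹ = 0)
    {z w : ℂ} (hz : ‖z‖ ≤ 1) (hw : ‖w‖ ≤ 1) : Q z w ≠ 0 := by
  have h1 := fun a b ha => h a b (Or.inl ha)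
  have h2 : ∀ a b : ℤ, 1 ≤ a →
      ∫ x : Torus, chi a b x * (Q (circ x.2) (circ x.1))⁻¹ = 0 := fun a b ha => by
    rw [← h b a (Or.inr ha), ← integral_torus_swap (hQ.continuous_chi_mul_inv h0 b a)]
    simp only [chi_apply, Prod.fst_swap, Prod.snd_swap, mul_comm]
  have h0' : ∀ t s, Q (circ s) (circ t) ≠ 0 := fun t s => h0 s t
  rcases hw.lt_or_eq with hw | hw
  · rcases hz.lt_or_eq with hz | hz
    · obtain ⟨P, hP⟩ := hQ.right z
      rw [← hP]
      have hne : ∀ s, P.eval (circ s) ≠ 0 := fun s => by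
        rw [hP]
        exact hQ.ne_zero_left h0 h1 hz s
      refine polynomial_eval_ne_zero_of_integral hne (fun a ha => ?_) hw
      -- Cauchy's formula for 1/Q(·, circ s) at the interior point z; it applies because
      -- `ne_zero_left` and `h0` exclude zeros in the closed disk.
      have h3 : ∀ s, 2 * Real.pi * (circ s ^ a * (P.eval (circ s))⁻¹) =
          ∫ t, circ t / (circ t - z) * (circ s ^ a * (Q (circ t) (circ s))⁻¹) := fun s => by
        obtain ⟨R, hR⟩ := hQ.left (circ s)
        have h4 := integral_circ_div_sub (diffContOnCl_inv_polynomial (Q := R) fun z hz => by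
          rw [hR]
          rcases hz.lt_or_eq with hz | hz
          · exact hQ.ne_zero_left h0 h1 hz s
          · obtain ⟨t, rfl⟩ := exists_circ_eq hz
            exact h0 t s) hz
        simp only [hR] at h4
        rw [hP, mul_left_comm, ← h4, ← integral_const_mul]
        congr 1
        ext t
        ring
      have h5 : ∫ s, 2 * Real.pi * (circ s ^ a * (P.eval (circ s))⁻¹) = 0 := by
        simp only [h3]
        have hcont : Continuous fun x : Torus =>
            circ x.1 / (circ x.1 - z) * (circ x.2 ^ a * (Q (circ x.1) (circ x.2))⁻¹) := by
          refine Continuous.mul (Continuous.div (by fun_prop) (by fun_prop) fun x hx => ?_)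
            (Continuous.mul (by fun_prop) (hQ.cont.inv₀ fun _ => h0 _ _))
          rw [sub_eq_zero] at hx
          rw [← hx, norm_circ] at hz
          exact lt_irrefl _ hz
        rw [← integral_torus hcont, integral_torus' hcont]
        simp only [integral_const_mul]
        have h6 := fun t => hQ.symm.inner_integral_eq_zero h0' h2 ha t
        simp [h6]
      rw [integral_const_mul] at h5
      simpa [Real.pi_ne_zero] using h5
    · obtain ⟨t, rfl⟩ := exists_circ_eq hz
      exact hQ.symm.ne_zero_left h0' h2 hw t
  · obtain ⟨s, rfl⟩ := exists_circ_eq hw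
    rcases hz.lt_or_eq with hz | hz
    · exact hQ.ne_zero_left h0 h1 hz s
    · obtain ⟨t, rfl⟩ := exists_circ_eq hz
      exact h0 t s

lemma IsBiPoly.integral_eq_zero_left {Q : ℂ → ℂ → ℂ} (hQ : IsBiPoly Q)
    (h : ∀ z w, ‖z‖ ≤ 1 → ‖w‖ ≤ 1 → Q z w ≠ 0) {a b : ℤ} (ha : 1 ≤ a) :
    ∫ x : Torus, chi a b x * (Q (circ x.1) (circ x.2))⁻¹ = 0 := by
  lift a to ℕ using by omega
  have h0 : ∀ t s, Q (circ t) (circ s) ≠ 0 := fun t s => h _ _ (by simp) (by simp)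
  rw [integral_torus (hQ.continuous_chi_mul_inv h0 _ _)]
  have h1 : ∀ s, ∫ t, chi a b (t, s) * (Q (circ t) (circ s))⁻¹ = 0 := fun s => by
    obtain ⟨P, hP⟩ := hQ.left (circ s)
    have := integral_circ_pow_mul (diffContOnCl_inv_polynomial (Q := P) fun z hz => by
      rw [hP]; exact h _ _ hz (by simp)) (a := a) (by omega)
    simp only [hP] at this
    have h2 : ∀ t, chi a b (t, s) * (Q (circ t) (circ s))⁻¹ =
        circ s ^ b * (circ t ^ a * (Q (circ t) (circ s))⁻¹) := fun t => by
      simp only [chi_apply, zpow_natCast]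
      ring
    simp only [h2, integral_const_mul, this, mul_zero]
  simp [h1]

lemma IsBiPoly.integral_eq_zero {Q : ℂ → ℂ → ℂ} (hQ : IsBiPoly Q)
    (h : ∀ z w, ‖z‖ ≤ 1 → ‖w‖ ≤ 1 → Q z w ≠ 0) {a b : ℤ} (hab : 1 ≤ a ∨ 1 ≤ b) :
    ∫ x : Torus, chi a b x * (Q (circ x.1) (circ x.2))⁻¹ = 0 := by
  rcases hab with ha | hb
  · exact hQ.integral_eq_zero_left h ha
  · have h0 : ∀ t s, Q (circ t) (circ s) ≠ 0 := fun t s => h _ _ (by simp) (by simp)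
    rw [← integral_torus_swap (hQ.continuous_chi_mul_inv h0 a b),
      ← hQ.symm.integral_eq_zero_left (fun z w hz hw => h w z hw hz) (b := a) hb]
    simp only [chi_apply, Prod.fst_swap, Prod.snd_swap, mul_comm]

lemma isBiPoly_evalAt (q : Poly) : IsBiPoly (evalAt q) where
  left w := by
    refine ⟨MvPolynomial.aeval ![Polynomial.X, Polynomial.C w] q, fun z => ?_⟩
    rw [evalAt]
    induction q using MvPolynomial.induction_on with
    | C a => simp
    | add p q hp hq => simp [hp, hq]
    | mul_X p i hp =>
      rw [map_mul, map_mul, Polynomial.eval_mul, hp]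
      congr 1
      fin_cases i <;> simp
  right z := by
    refine ⟨MvPolynomial.aeval ![Polynomial.C z, Polynomial.X] q, fun w => ?_⟩
    rw [evalAt]
    induction q using MvPolynomial.induction_on with
    | C a => simp
    | add p q hp hq => simp [hp, hq]
    | mul_X p i hp =>
      rw [map_mul, map_mul, Polynomial.eval_mul, hp]
      congr 1
      fin_cases i <;> simp
  cont := by
    have : (fun x : Torus => evalAt q (circ x.1) (circ x.2)) = emb q := by
      ext x
      rw [emb_apply]
      rfl
    rw [this]
    exact (emb q).continuous

/-! ### The sesquilinear form and orthogonality -/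

section InnerProduct

variable (μ : Measure Torus)

lemma ip_conj (p q : Poly) : starRingEnd ℂ (ip μ p q) = ip μ q p := by
  rw [ip, ip, map_mul, ← integral_conj]
  congr 1
  · simp [map_ofNat]
  · simp [mul_comm]

lemma ip_eq_zero_comm {p q : Poly} : ip μ p q = 0 ↔ ip μ q p = 0 := by
  rw [← ip_conj, map_eq_zero]

lemma ip_self (p : Poly) :
    ip μ p p = ((1 / (2 * Real.pi) ^ 2 * ∫ x, ‖onTorus p x‖ ^ 2 ∂μ : ℝ) : ℂ) := by
  rw [ip]
  push_cast
  rw [← integral_complex_ofReal]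
  simp [Complex.mul_conj, Complex.normSq_eq_norm_sq]

/-- `f` is orthogonal to the subspace `S`. -/
def Orth (f : Poly) (S : Submodule ℂ Poly) : Prop := ∀ g ∈ S, ip μ f g = 0

variable {μ}

lemma PosDefinite.ip_self_pos (hμ : PosDefinite μ) {p : Poly} (hp : p ≠ 0) :
    0 < (ip μ p p).re := by
  rw [ip_self, Complex.ofReal_re]
  exact hμ p hp

lemma PosDefinite.eq_zero (hμ : PosDefinite μ) {p : Poly} (hp : ip μ p p = 0) : p = 0 := by
  by_contra h
  have := hμ.ip_self_pos h
  simp [hp] at this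

lemma Orth.mono {f : Poly} {S T : Submodule ℂ Poly} (h : Orth μ f T) (hST : S ≤ T) :
    Orth μ f S := fun g hg => h g (hST hg)

variable [IsFiniteMeasure μ]

variable (μ)

lemma ip_eq_intL (p q : Poly) :
    ip μ p q = 1 / (2 * (Real.pi : ℂ)) ^ 2 * intL μ (emb p * star (emb q)) := by
  simp [ip, intL_apply, emb_apply]

/-- `⟨p, q⟩` as a linear functional of `p`. -/
def ipL (q : Poly) : Poly →ₗ[ℂ] ℂ where
  toFun p := ip μ p q
  map_add' p p' := by simp only [ip_eq_intL, map_add, add_mul, mul_add]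
  map_smul' c p := by
    simp only [ip_eq_intL, map_smul, smul_mul_assoc, smul_eq_mul, RingHom.id_apply]
    ring

lemma ipL_apply (p q : Poly) : ipL μ q p = ip μ p q := rfl

lemma ip_sub_left (p p' q : Poly) : ip μ (p - p') q = ip μ p q - ip μ p' q :=
  map_sub (ipL μ q) p p'

lemma ip_add_left (p p' q : Poly) : ip μ (p + p') q = ip μ p q + ip μ p' q :=
  map_add (ipL μ q) p p'

lemma ip_smul_left (c : ℂ) (p q : Poly) : ip μ (c • p) q = c * ip μ p q :=
  map_smul (ipL μ q) c p

lemma ip_smul_right (c : ℂ) (p q : Poly) : ip μ p (c • q) = starRingEnd ℂ c * ip μ p q := by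
  rw [← ip_conj, ip_smul_left, map_mul, ip_conj]

lemma ip_add_right (p q q' : Poly) : ip μ p (q + q') = ip μ p q + ip μ p q' := by
  rw [← ip_conj, ip_add_left, map_add, ip_conj, ip_conj]

/-- Monomials are unimodular on the bicircle: this is the doubly Toeplitz structure of the moments.
-/
lemma ip_mono_mul (a b : ℕ) (p q : Poly) : ip μ (mono a b * p) (mono a b * q) = ip μ p q := by
  rw [ip_eq_intL, ip_eq_intL, map_mul emb, map_mul emb, star_mul', emb_mono, mul_mul_mul_comm,
    star_chi, chi_mul]
  simp [chi_zero]

lemma ip_X0_mul (p q : Poly) :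
    ip μ (MvPolynomial.X 0 * p) (MvPolynomial.X 0 * q) = ip μ p q := by
  simpa [mono] using ip_mono_mul μ 1 0 p q

lemma ip_X1_mul (p q : Poly) :
    ip μ (MvPolynomial.X 1 * p) (MvPolynomial.X 1 * q) = ip μ p q := by
  simpa [mono] using ip_mono_mul μ 0 1 p q

variable {μ}

lemma orth_span {f : Poly} {s : Set Poly} :
    Orth μ f (Submodule.span ℂ s) ↔ ∀ g ∈ s, ip μ f g = 0 := by
  refine ⟨fun h g hg => h g (Submodule.subset_span hg), fun h g hg => ?_⟩
  have : Submodule.span ℂ s ≤ LinearMap.ker (ipL μ f) := by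
    rw [Submodule.span_le]
    exact fun g hg => (ip_eq_zero_comm μ).mp (h g hg)
  exact (ip_eq_zero_comm μ).mp (this hg)

lemma Orth.sup {f : Poly} {S T : Submodule ℂ Poly} (h : Orth μ f S) (h' : Orth μ f T) :
    Orth μ f (S ⊔ T) := by
  intro g hg
  obtain ⟨x, hx, y, hy, rfl⟩ := Submodule.mem_sup.mp hg
  rw [ip_add_right, h x hx, h' y hy, add_zero]

lemma orth_of_mem_span {s : Set Poly} {S : Submodule ℂ Poly} (h : ∀ f ∈ s, Orth μ f S)
    {f : Poly} (hf : f ∈ Submodule.span ℂ s) : Orth μ f S := by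
  intro g hg
  have : Submodule.span ℂ s ≤ LinearMap.ker (ipL μ g) := by
    rw [Submodule.span_le]
    exact fun f hf => h f hf g hg
  exact this hf

/-- The component of `f` in `A` is orthogonal to itself, hence zero by definiteness. -/
lemma mem_span_of_orth (hμ : PosDefinite μ) {A : Submodule ℂ Poly} {s : Set Poly}
    (hs : ∀ g ∈ s, Orth μ g A) {f : Poly} (hf : f ∈ A ⊔ Submodule.span ℂ s)
    (hfA : Orth μ f A) : f ∈ Submodule.span ℂ s := by
  obtain ⟨x, hx, y, hy, rfl⟩ := Submodule.mem_sup.mp hf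
  have h1 : ip μ x x = 0 := by
    have := hfA x hx
    rwa [ip_add_left, orth_of_mem_span hs hy x hx, add_zero] at this
  rwa [hμ.eq_zero h1, zero_add]

end InnerProduct

/-! ### Gram–Schmidt orthonormalization -/

section GramSchmidt

variable {μ : Measure Torus} [IsFiniteMeasure μ] {e : ℕ → Poly}

lemma orthonormalize_spec (hμ : PosDefinite μ) (he : LinearIndependent ℂ e) (k : ℕ) :
    (∀ j < k, ip μ (orthonormalize μ e k) (orthonormalize μ e j) = 0) ∧
    ip μ (orthonormalize μ e k) (orthonormalize μ e k) = 1 ∧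
    ∃ c : ℝ, 0 < c ∧ ∃ r ∈ Submodule.span ℂ (e '' Set.Iio k),
      orthonormalize μ e k = (c : ℂ) • (e k - r) := by
  induction k using Nat.strong_induction_on with
  | _ k ih =>
  set r : Poly := ∑ j : Fin k,
    MvPolynomial.C (ip μ (e k) (orthonormalize μ e j)) * orthonormalize μ e j with hr
  have ho : orthonormalize μ e k =
      ((1 / Real.sqrt (ip μ (e k - r) (e k - r)).re : ℝ) : ℂ) • (e k - r) := by
    rw [orthonormalize, MvPolynomial.smul_eq_C_mul]
  have hmem : ∀ j < k, orthonormalize μ e j ∈ Submodule.span ℂ (e '' Set.Iio k) := by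
    intro j hj
    obtain ⟨-, -, c, -, s, hs, h⟩ := ih j hj
    rw [h]
    refine Submodule.smul_mem _ _ (Submodule.sub_mem _ (Submodule.subset_span ⟨j, hj, rfl⟩) ?_)
    exact Submodule.span_mono (Set.image_mono fun x hx => lt_trans hx hj) hs
  have hrm : r ∈ Submodule.span ℂ (e '' Set.Iio k) := by
    refine Submodule.sum_mem _ fun j _ => ?_
    rw [← MvPolynomial.smul_eq_C_mul]
    exact Submodule.smul_mem _ _ (hmem j j.isLt)
  have hne : e k - r ≠ 0 := by
    intro h
    rw [sub_eq_zero] at h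
    exact he.notMem_span_image (s := Set.Iio k) (x := k) (by simp) (h ▸ hrm)
  have hpos := hμ.ip_self_pos hne
  have horth : ∀ j < k, ip μ (e k - r) (orthonormalize μ e j) = 0 := by
    intro j hj
    rw [ip_sub_left, ← ipL_apply μ r, hr, map_sum]
    simp only [← MvPolynomial.smul_eq_C_mul, map_smul, ipL_apply, smul_eq_mul]
    rw [Finset.sum_eq_single ⟨j, hj⟩]
    · rw [(ih j hj).2.1, mul_one, sub_self]
    · intro i _ hij
      rcases lt_or_gt_of_ne (fun h => hij (Fin.ext h) : (i : ℕ) ≠ j) with h | h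
      · rw [(ip_eq_zero_comm μ).mp ((ih j hj).1 i h), mul_zero]
      · rw [(ih i i.isLt).1 j h, mul_zero]
    · simp
  refine ⟨fun j hj => ?_, ?_, _, by positivity, r, hrm, ho⟩
  · rw [ho, ip_smul_left, horth j hj, mul_zero]
  · rw [ho, ip_smul_left, ip_smul_right, Complex.conj_ofReal, ip_self]
    rw [ip_self, Complex.ofReal_re] at *
    generalize 1 / (2 * Real.pi) ^ 2 * ∫ x, ‖onTorus (e k - r) x‖ ^ 2 ∂μ = d at *
    rw [← Complex.ofReal_mul, ← Complex.ofReal_mul, ← Complex.ofReal_one]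
    congr 1
    have := Real.sq_sqrt hpos.le
    have h2 := (Real.sqrt_pos.mpr hpos).ne'
    field_simp
    exact this.symm

lemma orthonormalize_mem_span (hμ : PosDefinite μ) (he : LinearIndependent ℂ e) {j k : ℕ}
    (hjk : j < k) : orthonormalize μ e j ∈ Submodule.span ℂ (e '' Set.Iio k) := by
  obtain ⟨-, -, c, -, s, hs, h⟩ := orthonormalize_spec hμ he j
  rw [h]
  refine Submodule.smul_mem _ _ (Submodule.sub_mem _ (Submodule.subset_span ⟨j, hjk, rfl⟩) ?_)
  exact Submodule.span_mono (Set.image_mono fun x hx => lt_trans hx hjk) hs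

lemma mem_span_orthonormalize (hμ : PosDefinite μ) (he : LinearIndependent ℂ e) (k : ℕ) :
    e k ∈ Submodule.span ℂ (orthonormalize μ e '' Set.Iic k) := by
  induction k using Nat.strong_induction_on with
  | _ k ih =>
  obtain ⟨-, -, c, hc, s, hs, h⟩ := orthonormalize_spec hμ he k
  have hc' : (c : ℂ) ≠ 0 := by exact_mod_cast hc.ne'
  have h1 : e k = (c : ℂ)⁻¹ • orthonormalize μ e k + s := by
    rw [h, smul_smul, inv_mul_cancel₀ hc', one_smul, sub_add_cancel]
  rw [h1]
  refine Submodule.add_mem _ (Submodule.smul_mem _ _ (Submodule.subset_span ⟨k, ?_, rfl⟩)) ?_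
  · exact le_refl k
  · refine (Submodule.span_le.mpr ?_ : Submodule.span ℂ (e '' Set.Iio k) ≤ _) hs
    rintro _ ⟨j, hj, rfl⟩
    have hsub : Set.Iic j ⊆ Set.Iic k := Set.Iic_subset_Iic.mpr (le_of_lt hj)
    exact Submodule.span_mono (Set.image_mono hsub) (ih j hj)

lemma orthonormalize_orth (hμ : PosDefinite μ) (he : LinearIndependent ℂ e) {k N : ℕ}
    (hN : N ≤ k) : Orth μ (orthonormalize μ e k) (Submodule.span ℂ (e '' Set.Iio N)) := by
  have h : Orth μ (orthonormalize μ e k)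
      (Submodule.span ℂ (orthonormalize μ e '' Set.Iio N)) := by
    rw [orth_span]
    rintro _ ⟨j, hj, rfl⟩
    exact (orthonormalize_spec hμ he k).1 j (lt_of_lt_of_le hj hN)
  refine h.mono (Submodule.span_le.mpr ?_)
  rintro _ ⟨j, hj, rfl⟩
  have hsub : Set.Iic j ⊆ Set.Iio N := fun x hx => lt_of_le_of_lt (Set.mem_Iic.mp hx) hj
  exact Submodule.span_mono (Set.image_mono hsub) (mem_span_orthonormalize hμ he j)

lemma span_le_sup_orthonormalize (hμ : PosDefinite μ) (he : LinearIndependent ℂ e) (N M : ℕ) :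
    Submodule.span ℂ (e '' Set.Iio (N + M)) ≤ Submodule.span ℂ (e '' Set.Iio N) ⊔
      Submodule.span ℂ {p | ∃ l < M, p = orthonormalize μ e (N + l)} := by
  refine Submodule.span_le.mpr ?_
  rintro _ ⟨k, hk, rfl⟩
  refine (Submodule.span_le.mpr ?_ : Submodule.span ℂ (orthonormalize μ e '' Set.Iic k) ≤ _)
    (mem_span_orthonormalize hμ he k)
  rintro _ ⟨j, hj, rfl⟩
  rcases lt_or_ge j N with h | h
  · exact Submodule.mem_sup_left (orthonormalize_mem_span hμ he h)
  · refine Submodule.mem_sup_right (Submodule.subset_span ⟨j - N, ?_, ?_⟩)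
    · simp only [Set.mem_Iio, Set.mem_Iic] at hk hj
      omega
    · congr 1
      omega

end GramSchmidt

/-! ### Polynomials of bounded bidegree -/

section Rectangles

/-- The span of the monomials `z^a w^b` with `a < i` and `b < j`. -/
def V (i j : ℕ) : Submodule ℂ Poly :=
  Submodule.span ℂ {p | ∃ a < i, ∃ b < j, p = mono a b}

lemma mono_mem_V {i j a b : ℕ} (ha : a < i) (hb : b < j) : mono a b ∈ V i j :=
  Submodule.subset_span ⟨a, ha, b, hb, rfl⟩

lemma V_mono {i j i' j' : ℕ} (hi : i ≤ i') (hj : j ≤ j') : V i j ≤ V i' j' := by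
  refine Submodule.span_mono ?_
  rintro _ ⟨a, ha, b, hb, rfl⟩
  exact ⟨a, by omega, b, by omega, rfl⟩

lemma orth_V {μ : Measure Torus} [IsFiniteMeasure μ] {f : Poly} {i j : ℕ} :
    Orth μ f (V i j) ↔ ∀ a < i, ∀ b < j, ip μ f (mono a b) = 0 := by
  rw [V, orth_span]
  refine ⟨fun h a ha b hb => h _ ⟨a, ha, b, hb, rfl⟩, ?_⟩
  rintro h _ ⟨a, ha, b, hb, rfl⟩
  exact h a ha b hb

lemma mono_mul_mem_V {i j k l : ℕ} {f : Poly} (hf : f ∈ V i j) :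
    mono k l * f ∈ V (k + i) (l + j) := by
  have : V i j ≤ (V (k + i) (l + j)).comap (LinearMap.mulLeft ℂ (mono k l)) := by
    refine Submodule.span_le.mpr ?_
    rintro _ ⟨a, ha, b, hb, rfl⟩
    have : mono k l * mono a b = mono (k + a) (l + b) := by
      simp only [mono]
      ring
    simp only [SetLike.mem_coe, Submodule.mem_comap, LinearMap.mulLeft_apply, this]
    exact mono_mem_V (by omega) (by omega)
  exact this hf

lemma mono_eq_monomial (a b : ℕ) :
    mono a b = MvPolynomial.monomial (Finsupp.single 0 a + Finsupp.single 1 b) 1 := by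
  rw [mono, MvPolynomial.X_pow_eq_monomial, MvPolynomial.X_pow_eq_monomial,
    MvPolynomial.monomial_mul, one_mul]

lemma single_add_single_injective : Function.Injective fun ab : ℕ × ℕ =>
    (Finsupp.single 0 ab.1 + Finsupp.single 1 ab.2 : Fin 2 →₀ ℕ) := by
  intro x y h
  have h0 := DFunLike.congr_fun h 0
  have h1 := DFunLike.congr_fun h 1
  simp at h0 h1
  exact Prod.ext h0 h1

lemma linearIndependent_mono {g : ℕ → ℕ × ℕ} (hg : Function.Injective g) :
    LinearIndependent ℂ fun k => mono (g k).1 (g k).2 := by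
  have := (MvPolynomial.basisMonomials (Fin 2) ℂ).linearIndependent.comp
    (fun k => (Finsupp.single 0 (g k).1 + Finsupp.single 1 (g k).2 : Fin 2 →₀ ℕ))
    (single_add_single_injective.comp hg)
  have h : (fun k => mono (g k).1 (g k).2) = ⇑(MvPolynomial.basisMonomials (Fin 2) ℂ) ∘
      fun k => (Finsupp.single 0 (g k).1 + Finsupp.single 1 (g k).2 : Fin 2 →₀ ℕ) := by
    ext1 k
    simp [mono_eq_monomial]
  rw [h]
  exact this

lemma linearIndependent_lex (m : ℕ) :
    LinearIndependent ℂ fun k : ℕ => mono (k / (m + 1)) (k % (m + 1)) :=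
  linearIndependent_mono (g := fun k => (k / (m + 1), k % (m + 1))) fun x y h => by
    simp only [Prod.mk.injEq] at h
    rw [← Nat.div_add_mod x (m + 1), ← Nat.div_add_mod y (m + 1), h.1, h.2]

lemma linearIndependent_revlex (n : ℕ) :
    LinearIndependent ℂ fun k : ℕ => mono (k % (n + 1)) (k / (n + 1)) :=
  linearIndependent_mono (g := fun k => (k % (n + 1), k / (n + 1))) fun x y h => by
    simp only [Prod.mk.injEq] at h
    rw [← Nat.div_add_mod x (n + 1), ← Nat.div_add_mod y (n + 1), h.1, h.2]

lemma span_lex (i m : ℕ) :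
    Submodule.span ℂ ((fun k : ℕ => mono (k / (m + 1)) (k % (m + 1))) '' Set.Iio (i * (m + 1))) =
      V i (m + 1) := by
  congr 1
  ext p
  constructor
  · rintro ⟨k, hk, rfl⟩
    exact ⟨_, Nat.div_lt_of_lt_mul (by rwa [mul_comm]), _, Nat.mod_lt _ (by omega), rfl⟩
  · rintro ⟨a, ha, b, hb, rfl⟩
    refine ⟨b + (m + 1) * a, ?_, ?_⟩
    · rw [Set.mem_Iio]
      nlinarith
    · simp [Nat.add_mul_div_left, Nat.add_mul_mod_self_left, Nat.div_eq_of_lt hb,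
        Nat.mod_eq_of_lt hb]

lemma span_revlex (j n : ℕ) :
    Submodule.span ℂ ((fun k : ℕ => mono (k % (n + 1)) (k / (n + 1))) '' Set.Iio (j * (n + 1))) =
      V (n + 1) j := by
  congr 1
  ext p
  constructor
  · rintro ⟨k, hk, rfl⟩
    exact ⟨_, Nat.mod_lt _ (by omega), _, Nat.div_lt_of_lt_mul (by rwa [mul_comm]), rfl⟩
  · rintro ⟨a, ha, b, hb, rfl⟩
    refine ⟨a + (n + 1) * b, ?_, ?_⟩
    · rw [Set.mem_Iio]
      nlinarith
    · simp [Nat.add_mul_div_left, Nat.add_mul_mod_self_left, Nat.div_eq_of_lt ha,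
        Nat.mod_eq_of_lt ha]

end Rectangles

/-! ### The orthonormal polynomials as bases of orthogonal complements -/

section Phi

variable {μ : Measure Torus} [IsFiniteMeasure μ]

lemma phi_orth (hμ : PosDefinite μ) (i j l : ℕ) : Orth μ (phi μ i j l) (V i (j + 1)) := by
  rw [← span_lex]
  exact orthonormalize_orth hμ (linearIndependent_lex j) (by omega)

lemma phi_mem (hμ : PosDefinite μ) {i j l : ℕ} (hl : l ≤ j) :
    phi μ i j l ∈ V (i + 1) (j + 1) := by
  rw [← span_lex]
  exact orthonormalize_mem_span hμ (linearIndependent_lex j) (by nlinarith)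

lemma V_le_sup_phi (hμ : PosDefinite μ) (i j : ℕ) :
    V (i + 1) (j + 1) ≤ V i (j + 1) ⊔ Submodule.span ℂ {p | ∃ l < j + 1, p = phi μ i j l} := by
  rw [← span_lex, ← span_lex, add_one_mul]
  exact span_le_sup_orthonormalize hμ (linearIndependent_lex j) _ _

lemma mem_span_phi (hμ : PosDefinite μ) {i j : ℕ} {f : Poly} (hf : f ∈ V (i + 1) (j + 1))
    (h : Orth μ f (V i (j + 1))) : f ∈ Submodule.span ℂ {p | ∃ l < j + 1, p = phi μ i j l} := by
  refine mem_span_of_orth hμ ?_ (V_le_sup_phi hμ i j hf) h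
  rintro _ ⟨l, _, rfl⟩
  exact phi_orth hμ i j l

lemma phiTilde_orth (hμ : PosDefinite μ) (i j l : ℕ) :
    Orth μ (phiTilde μ i j l) (V (i + 1) j) := by
  rw [← span_revlex]
  exact orthonormalize_orth hμ (linearIndependent_revlex i) (by omega)

lemma phiTilde_mem (hμ : PosDefinite μ) {i j l : ℕ} (hl : l ≤ i) :
    phiTilde μ i j l ∈ V (i + 1) (j + 1) := by
  rw [← span_revlex]
  exact orthonormalize_mem_span hμ (linearIndependent_revlex i) (by nlinarith)

lemma V_le_sup_phiTilde (hμ : PosDefinite μ) (i j : ℕ) :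
    V (i + 1) (j + 1) ≤
      V (i + 1) j ⊔ Submodule.span ℂ {p | ∃ l < i + 1, p = phiTilde μ i j l} := by
  rw [← span_revlex, ← span_revlex, add_one_mul]
  exact span_le_sup_orthonormalize hμ (linearIndependent_revlex i) _ _

lemma mem_span_phiTilde (hμ : PosDefinite μ) {i j : ℕ} {f : Poly} (hf : f ∈ V (i + 1) (j + 1))
    (h : Orth μ f (V (i + 1) j)) :
    f ∈ Submodule.span ℂ {p | ∃ l < i + 1, p = phiTilde μ i j l} := by
  refine mem_span_of_orth hμ ?_ (V_le_sup_phiTilde hμ i j hf) h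
  rintro _ ⟨l, _, rfl⟩
  exact phiTilde_orth hμ i j l

end Phi

/-! ### Reverse polynomials -/

section Reverse

lemma coeffAt_mono (a b a' b' : ℕ) :
    coeffAt (mono a b) a' b' = if a = a' ∧ b = b' then 1 else 0 := by
  rw [coeffAt, mono_eq_monomial, MvPolynomial.coeff_monomial]
  congr 1
  simpa using single_add_single_injective.eq_iff (a := (a, b)) (b := (a', b'))

lemma eq_sum_of_mem_V {i j : ℕ} {f : Poly} (hf : f ∈ V i j) :
    f = ∑ a ∈ Finset.range i, ∑ b ∈ Finset.range j, coeffAt f a b • mono a b := by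
  induction hf using Submodule.span_induction with
  | mem x hx =>
    obtain ⟨a, ha, b, hb, rfl⟩ := hx
    rw [Finset.sum_eq_single_of_mem a (Finset.mem_range.mpr ha),
      Finset.sum_eq_single_of_mem b (Finset.mem_range.mpr hb)]
    · simp [coeffAt_mono]
    · intro b' _ hb'
      simp [coeffAt_mono, hb'.symm]
    · intro a' _ ha'
      simp [coeffAt_mono, ha'.symm]
  | zero => simp [coeffAt]
  | add x y _ _ hx hy =>
    conv_lhs => rw [hx, hy]
    simp only [coeffAt, MvPolynomial.coeff_add, add_smul, Finset.sum_add_distrib]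
  | smul c x _ hx =>
    conv_lhs => rw [hx]
    simp only [coeffAt, MvPolynomial.coeff_smul, smul_assoc, Finset.smul_sum]

lemma reverse_eq_sum (i j : ℕ) (f : Poly) :
    reverse i j f = ∑ a ∈ Finset.range (i + 1), ∑ b ∈ Finset.range (j + 1),
      starRingEnd ℂ (coeffAt f a b) • mono (i - a) (j - b) := by
  rw [reverse, ← Finset.sum_range_reflect _ (i + 1)]
  refine Finset.sum_congr rfl fun a ha => ?_
  rw [← Finset.sum_range_reflect _ (j + 1)]
  refine Finset.sum_congr rfl fun b hb => ?_
  rw [Finset.mem_range] at ha hb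
  rw [MvPolynomial.smul_eq_C_mul, show i - (i + 1 - 1 - a) = a by omega,
    show j - (j + 1 - 1 - b) = b by omega, Nat.add_sub_cancel, Nat.add_sub_cancel]

lemma reverse_mem (i j : ℕ) (f : Poly) : reverse i j f ∈ V (i + 1) (j + 1) := by
  rw [reverse_eq_sum]
  refine Submodule.sum_mem _ fun a _ => Submodule.sum_mem _ fun b _ => Submodule.smul_mem _ _ ?_
  exact mono_mem_V (by omega) (by omega)

/-- Reversal is conjugation up to a character, since 1/z̄ = z on the circle. -/
lemma emb_reverse {i j : ℕ} {f : Poly} (hf : f ∈ V (i + 1) (j + 1)) :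
    emb (reverse i j f) = chi i j * star (emb f) := by
  conv_rhs => rw [eq_sum_of_mem_V hf]
  rw [reverse_eq_sum]
  simp only [map_sum, map_smul, emb_mono, star_sum, star_smul, star_chi, Finset.mul_sum,
    mul_smul_comm, chi_mul]
  refine Finset.sum_congr rfl fun a ha => Finset.sum_congr rfl fun b hb => ?_
  rw [Finset.mem_range] at ha hb
  rw [Nat.cast_sub (by omega), Nat.cast_sub (by omega)]
  rfl

lemma emb_reverse_reverse {i j : ℕ} {f : Poly} (hf : f ∈ V (i + 1) (j + 1)) :
    emb (reverse i j (reverse i j f)) = emb f := by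
  rw [emb_reverse (reverse_mem i j f), emb_reverse hf, star_mul', star_star, ← mul_assoc,
    star_chi, chi_mul]
  simp [chi_zero]

lemma mem_V_of_degreeOf_le {i j : ℕ} {f : Poly} (h0 : f.degreeOf 0 ≤ i) (h1 : f.degreeOf 1 ≤ j) :
    f ∈ V (i + 1) (j + 1) := by
  rw [MvPolynomial.as_sum f]
  refine Submodule.sum_mem _ fun s hs => ?_
  have hs' : s = Finsupp.single 0 (s 0) + Finsupp.single 1 (s 1) := by
    ext k
    fin_cases k <;> simp
  have : MvPolynomial.monomial s (f.coeff s) = f.coeff s • mono (s 0) (s 1) := by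
    rw [mono_eq_monomial, MvPolynomial.smul_monomial, ← hs', smul_eq_mul, mul_one]
  rw [this]
  refine Submodule.smul_mem _ _ (mono_mem_V ?_ ?_)
  · have := MvPolynomial.monomial_le_degreeOf 0 hs
    omega
  · have := MvPolynomial.monomial_le_degreeOf 1 hs
    omega

lemma degreeOf_le_of_mem_V {i j : ℕ} {f : Poly} (hf : f ∈ V (i + 1) (j + 1)) :
    f.degreeOf 0 ≤ i ∧ f.degreeOf 1 ≤ j := by
  rw [MvPolynomial.degreeOf_le_iff, MvPolynomial.degreeOf_le_iff]
  have key : ∀ s, f.coeff s ≠ 0 → s 0 ≤ i ∧ s 1 ≤ j := by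
    intro s hs
    rw [eq_sum_of_mem_V hf, MvPolynomial.coeff_sum] at hs
    obtain ⟨a, ha, h⟩ := Finset.exists_ne_zero_of_sum_ne_zero hs
    rw [MvPolynomial.coeff_sum] at h
    obtain ⟨b, hb, h⟩ := Finset.exists_ne_zero_of_sum_ne_zero h
    rw [mono_eq_monomial, MvPolynomial.coeff_smul, MvPolynomial.coeff_monomial] at h
    have hs : Finsupp.single 0 a + Finsupp.single 1 b = s := by
      by_contra hne
      simp [hne] at h
    rw [Finset.mem_range] at ha hb
    subst hs
    simp
    omega
  exact ⟨fun s hs => (key s (MvPolynomial.mem_support_iff.mp hs)).1,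
    fun s hs => (key s (MvPolynomial.mem_support_iff.mp hs)).2⟩

end Reverse

/-! ### The matrix conditions as orthogonality statements -/

section Conditions

variable (μ : Measure Torus)

/-- The orthogonality condition equivalent to `𝒦_{i,j} = 0`. -/
def KOrth (i j : ℕ) : Prop :=
  ∀ f ∈ V (i + 1) j, Orth μ f (V i j) → Orth μ f (V i (j + 1))

/-- The mirror image of `KOrth`. -/
def KOrth' (i j : ℕ) : Prop :=
  ∀ f ∈ V i (j + 1), Orth μ f (V i j) → Orth μ f (V (i + 1) j)

/-- The orthogonality condition equivalent to `Ê_{i+1,j} = 0`. -/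
def EOrth (i j : ℕ) : Prop :=
  ∀ f ∈ V (i + 1) (j + 1), Orth μ f (V i (j + 1)) →
    Orth μ (MvPolynomial.X 0 * f) (V (i + 1) (j + 1))

/-- The mirror image of `EOrth`. -/
def EOrth' (i j : ℕ) : Prop :=
  ∀ f ∈ V (i + 1) (j + 1), Orth μ f (V (i + 1) j) →
    Orth μ (MvPolynomial.X 1 * f) (V (i + 1) (j + 1))

variable {μ}

lemma calK_eq_zero_iff (i j : ℕ) : calK μ (i + 1) (j + 1) = 0 ↔
    ∀ l < j + 1, ∀ k < i + 1, ip μ (phi μ (i + 1) j l) (phiTilde μ i (j + 1) k) = 0 := by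
  constructor
  · intro h l hl k hk
    have := congr_fun₂ h ⟨j - l, by omega⟩ ⟨i - k, by omega⟩
    simp only [calK, Matrix.of_apply, Phi, PhiTilde, Matrix.zero_apply] at this
    rwa [show j - (j - l) = l by omega, show i - (i - k) = k by omega] at this
  · intro h
    ext s t
    simp only [calK, Matrix.of_apply, Phi, PhiTilde, Matrix.zero_apply]
    exact h _ (by omega) _ (by omega)

lemma calK_zero_left (j : ℕ) : calK μ 0 j = 0 := by
  ext _ t
  exact t.elim0

lemma calK_zero_right (i : ℕ) : calK μ i 0 = 0 := by
  ext s
  exact s.elim0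

lemma EhatSucc_eq_zero_iff (i j : ℕ) : EhatSucc μ i j = 0 ↔ ∀ l < j + 1, ∀ k < j + 1,
    ip μ (MvPolynomial.X 0 * phi μ i j l) (reverse i j (phi μ i j k)) = 0 := by
  constructor
  · intro h l hl k hk
    have := congr_fun₂ h ⟨j - l, by omega⟩ ⟨j - k, by omega⟩
    simp only [EhatSucc, Matrix.of_apply, Phi, Matrix.zero_apply] at this
    rwa [show j - (j - l) = l by omega, show j - (j - k) = k by omega] at this
  · intro h
    ext s t
    simp only [EhatSucc, Matrix.of_apply, Phi, Matrix.zero_apply]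
    exact h _ (by omega) _ (by omega)

lemma EhatTildeSucc_eq_zero_iff (i j : ℕ) : EhatTildeSucc μ i j = 0 ↔ ∀ l < i + 1, ∀ k < i + 1,
    ip μ (MvPolynomial.X 1 * phiTilde μ i j l) (reverse i j (phiTilde μ i j k)) = 0 := by
  constructor
  · intro h l hl k hk
    have := congr_fun₂ h ⟨i - l, by omega⟩ ⟨i - k, by omega⟩
    simp only [EhatTildeSucc, Matrix.of_apply, PhiTilde, Matrix.zero_apply] at this
    rwa [show i - (i - l) = l by omega, show i - (i - k) = k by omega] at this
  · intro h
    ext s t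
    simp only [EhatTildeSucc, Matrix.of_apply, PhiTilde, Matrix.zero_apply]
    exact h _ (by omega) _ (by omega)

lemma V_zero_left (j : ℕ) : V 0 j = ⊥ := by
  rw [eq_bot_iff, V, Submodule.span_le]
  rintro _ ⟨a, ha, _⟩
  exact absurd ha (Nat.not_lt_zero a)

lemma V_zero_right (i : ℕ) : V i 0 = ⊥ := by
  rw [eq_bot_iff, V, Submodule.span_le]
  rintro _ ⟨a, ha, b, hb, _⟩
  exact absurd hb (Nat.not_lt_zero b)

variable [IsFiniteMeasure μ]

lemma orth_bot (f : Poly) : Orth μ f ⊥ := by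
  intro g hg
  rw [(Submodule.mem_bot ℂ).mp hg, ip_eq_intL]
  simp

lemma orth_zero (S : Submodule ℂ Poly) : Orth μ 0 S := by
  intro g _
  rw [ip_eq_intL]
  simp

/-- For positive indices, the two families paired in 𝒦 span the orthogonal complements of `V i j` in
`V (i + 1) j` and in `V i (j + 1)`. So 𝒦 = 0 says that these complements are orthogonal to each
other, which can be read from either side. -/
lemma KOrth_of_calK (hμ : PosDefinite μ) {i j : ℕ} (h : calK μ i j = 0) : KOrth μ i j := by
  intro f hf hfo
  cases i with
  | zero =>
    rw [V_zero_left]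
    exact orth_bot f
  | succ i =>
  cases j with
  | zero =>
    rw [V_zero_right, Submodule.mem_bot] at hf
    rw [hf]
    exact orth_zero _
  | succ j =>
    rw [calK_eq_zero_iff] at h
    refine (hfo.sup ?_).mono (V_le_sup_phiTilde hμ i (j + 1))
    refine orth_of_mem_span ?_ (mem_span_phi hμ hf hfo)
    rintro _ ⟨l, hl, rfl⟩
    rw [orth_span]
    rintro _ ⟨k, hk, rfl⟩
    exact h l hl k hk

lemma KOrth'_of_calK (hμ : PosDefinite μ) {i j : ℕ} (h : calK μ i j = 0) : KOrth' μ i j := by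
  intro f hf hfo
  cases i with
  | zero =>
    rw [V_zero_left, Submodule.mem_bot] at hf
    rw [hf]
    exact orth_zero _
  | succ i =>
  cases j with
  | zero =>
    rw [V_zero_right]
    exact orth_bot f
  | succ j =>
    rw [calK_eq_zero_iff] at h
    refine (hfo.sup ?_).mono (V_le_sup_phi hμ (i + 1) j)
    refine orth_of_mem_span ?_ (mem_span_phiTilde hμ hf hfo)
    rintro _ ⟨k, hk, rfl⟩
    rw [orth_span]
    rintro _ ⟨l, hl, rfl⟩
    rw [ip_eq_zero_comm]
    exact h l hl k hk

lemma calK_of_KOrth (hμ : PosDefinite μ) {i j : ℕ} (h : KOrth μ i j) : calK μ i j = 0 := by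
  cases i with
  | zero => exact calK_zero_left j
  | succ i =>
  cases j with
  | zero => exact calK_zero_right _
  | succ j =>
    rw [calK_eq_zero_iff]
    intro l hl k hk
    exact h _ (phi_mem hμ (by omega)) (phi_orth hμ _ _ _) _ (phiTilde_mem hμ (by omega))

/-- Turns a pairing with a reverse into an expression linear in `g`, which can be tested on a
spanning set. -/
lemma ip_reverse {i j : ℕ} {f g : Poly} (hg : g ∈ V (i + 1) (j + 1)) :
    ip μ f (reverse i j g) = ip μ (f * g) (mono i j) := by
  rw [ip_eq_intL, ip_eq_intL, emb_reverse hg, emb_mono, star_mul', star_star, map_mul emb]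
  congr 2
  ring

lemma orth_of_reverse {i j : ℕ} {f : Poly}
    (h : ∀ g ∈ V (i + 1) (j + 1), ip μ (f * g) (mono i j) = 0) :
    Orth μ f (V (i + 1) (j + 1)) := by
  intro g hg
  have h1 := h _ (reverse_mem i j g)
  rwa [← ip_reverse (reverse_mem i j g), ip_eq_intL, emb_reverse_reverse hg, ← ip_eq_intL] at h1

/-- `g ↦ ⟨f g, q⟩` as a linear functional. -/
def ipMulL (μ : Measure Torus) [IsFiniteMeasure μ] (f q : Poly) : Poly →ₗ[ℂ] ℂ :=
  (ipL μ q).comp (LinearMap.mulLeft ℂ f)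

lemma ipMulL_apply (f q g : Poly) : ipMulL μ f q g = ip μ (f * g) q := rfl

/-- Every test polynomial is the reverse of some `g`, split along `V i (j + 1)` and its complement.
The first part pairs to zero with `z f` by the orthogonality of `f`; the second produces exactly the
entries of Ê. -/
lemma EOrth_of_EhatSucc (hμ : PosDefinite μ) {i j : ℕ} (h : EhatSucc μ i j = 0) :
    EOrth μ i j := by
  rw [EhatSucc_eq_zero_iff] at h
  intro f hf hfo
  refine orth_of_reverse fun g hg => ?_
  have hle : V (i + 1) (j + 1) ≤
      LinearMap.ker (ipMulL μ (MvPolynomial.X 0 * f) (mono i j)) := by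
    refine (V_le_sup_phi hμ i j).trans (sup_le (Submodule.span_le.mpr ?_) ?_)
    · rintro _ ⟨a, ha, b, hb, rfl⟩
      -- Cancelling z^{1+a} w^b in ⟨z f z^a w^b, z^i w^j⟩ leaves this pairing; a < i makes the
      -- exponent i - 1 - a nonnegative.
      have h1 := (orth_V.mp hfo) (i - 1 - a) (by omega) (j - b) (by omega)
      rw [SetLike.mem_coe, LinearMap.mem_ker, ipMulL_apply]
      rw [← ip_mono_mul μ (1 + a) b] at h1
      convert h1 using 2
      · simp only [mono]
        ring
      · simp only [mono, mul_mul_mul_comm, ← pow_add]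
        congr 2 <;> omega
    · refine Submodule.span_le.mpr ?_
      rintro _ ⟨k, hk, rfl⟩
      rw [SetLike.mem_coe, LinearMap.mem_ker, ipMulL_apply,
        ← ip_reverse (phi_mem hμ (by omega))]
      have : Submodule.span ℂ {p | ∃ l < j + 1, p = phi μ i j l} ≤
          LinearMap.ker ((ipL μ (reverse i j (phi μ i j k))).comp
            (LinearMap.mulLeft ℂ (MvPolynomial.X 0))) := by
        refine Submodule.span_le.mpr ?_
        rintro _ ⟨l, hl, rfl⟩
        exact h l hl k hk
      exact this (mem_span_phi hμ hf hfo)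
  exact hle hg

lemma EOrth'_of_EhatTildeSucc (hμ : PosDefinite μ) {i j : ℕ} (h : EhatTildeSucc μ i j = 0) :
    EOrth' μ i j := by
  rw [EhatTildeSucc_eq_zero_iff] at h
  intro f hf hfo
  refine orth_of_reverse fun g hg => ?_
  have hle : V (i + 1) (j + 1) ≤
      LinearMap.ker (ipMulL μ (MvPolynomial.X 1 * f) (mono i j)) := by
    refine (V_le_sup_phiTilde hμ i j).trans (sup_le (Submodule.span_le.mpr ?_) ?_)
    · rintro _ ⟨a, ha, b, hb, rfl⟩
      have h1 := (orth_V.mp hfo) (i - a) (by omega) (j - 1 - b) (by omega)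
      rw [SetLike.mem_coe, LinearMap.mem_ker, ipMulL_apply]
      rw [← ip_mono_mul μ a (1 + b)] at h1
      convert h1 using 2
      · simp only [mono]
        ring
      · simp only [mono, mul_mul_mul_comm, ← pow_add]
        congr 2 <;> omega
    · refine Submodule.span_le.mpr ?_
      rintro _ ⟨k, hk, rfl⟩
      rw [SetLike.mem_coe, LinearMap.mem_ker, ipMulL_apply,
        ← ip_reverse (phiTilde_mem hμ (by omega))]
      have : Submodule.span ℂ {p | ∃ l < i + 1, p = phiTilde μ i j l} ≤
          LinearMap.ker ((ipL μ (reverse i j (phiTilde μ i j k))).comp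
            (LinearMap.mulLeft ℂ (MvPolynomial.X 1))) := by
        refine Submodule.span_le.mpr ?_
        rintro _ ⟨l, hl, rfl⟩
        exact h l hl k hk
      exact this (mem_span_phiTilde hμ hf hfo)
  exact hle hg

lemma EhatSucc_of_EOrth (hμ : PosDefinite μ) {i j : ℕ} (h : EOrth μ i j) :
    EhatSucc μ i j = 0 := by
  rw [EhatSucc_eq_zero_iff]
  intro l hl k _
  exact h _ (phi_mem hμ (by omega)) (phi_orth hμ _ _ _) _ (reverse_mem _ _ _)

lemma EhatTildeSucc_of_EOrth' (hμ : PosDefinite μ) {i j : ℕ} (h : EOrth' μ i j) :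
    EhatTildeSucc μ i j = 0 := by
  rw [EhatTildeSucc_eq_zero_iff]
  intro l hl k _
  exact h _ (phiTilde_mem hμ (by omega)) (phiTilde_orth hμ _ _ _) _ (reverse_mem _ _ _)

end Conditions

/-! ### Lipschitz bounds for trigonometric polynomials -/

section Lipschitz

lemma norm_circ_sub_circ_le (s t : AddCircle (2 * Real.pi)) : ‖circ s - circ t‖ ≤ dist s t := by
  have h1 : ‖circ s - circ t‖ = ‖circ (s - t) - 1‖ := by
    have : circ s = circ (s - t) * circ t := by
      rw [circ, circ, circ, ← Circle.coe_mul, ← AddCircle.toCircle_add, sub_add_cancel]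
    rw [this, ← sub_one_mul, norm_mul, norm_circ, mul_one]
  rw [h1, dist_eq_norm]
  generalize s - t = u
  induction u using QuotientAddGroup.induction_on with
  | H θ =>
  change ‖circ (θ : AddCircle (2 * Real.pi)) - 1‖ ≤ ‖(θ : AddCircle (2 * Real.pi))‖
  rw [AddCircle.norm_eq]
  set k : ℤ := round ((2 * Real.pi)⁻¹ * θ)
  have h2 : (θ : AddCircle (2 * Real.pi)) = ((θ - k * (2 * Real.pi) : ℝ) : AddCircle _) := by
    rw [AddCircle.coe_sub, ← zsmul_eq_mul, AddCircle.coe_zsmul, AddCircle.coe_period, smul_zero,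
      sub_zero]
  rw [h2, circ_coe, circleMap]
  have := Real.norm_exp_I_mul_ofReal_sub_one_le (x := θ - k * (2 * Real.pi))
  rw [mul_comm Complex.I] at this
  simpa using this

lemma exists_lipschitz_emb (p : Poly) :
    ∃ C : ℝ, ∀ x y, ‖emb p x - emb p y‖ ≤ C * dist x y := by
  induction p using MvPolynomial.induction_on with
  | C a => exact ⟨0, fun x y => by simp [emb, Algebra.algebraMap_eq_smul_one]⟩
  | add p q hp hq =>
    obtain ⟨C, hC⟩ := hp
    obtain ⟨D, hD⟩ := hq
    refine ⟨C + D, fun x y => ?_⟩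
    rw [map_add, ContinuousMap.add_apply, ContinuousMap.add_apply, add_sub_add_comm, add_mul]
    exact (norm_add_le _ _).trans (add_le_add (hC x y) (hD x y))
  | mul_X p i hp =>
    obtain ⟨C, hC⟩ := hp
    have hX : ∀ x y, ‖emb (MvPolynomial.X i) x - emb (MvPolynomial.X i) y‖ ≤ dist x y ∧
        ‖emb (MvPolynomial.X i) x‖ = 1 := by
      intro x y
      fin_cases i
      · simp only [Fin.zero_eta, emb_X0, chi_apply, zpow_one, zpow_zero, mul_one, norm_circ,
          and_true]
        exact (norm_circ_sub_circ_le _ _).trans (le_max_left _ _)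
      · simp only [Fin.mk_one, emb_X1, chi_apply, zpow_one, zpow_zero, one_mul, norm_circ,
          and_true]
        exact (norm_circ_sub_circ_le _ _).trans (le_max_right _ _)
    refine ⟨C + ‖emb p‖, fun x y => ?_⟩
    rw [map_mul, ContinuousMap.mul_apply, ContinuousMap.mul_apply]
    have h1 : emb p x * emb (MvPolynomial.X i) x - emb p y * emb (MvPolynomial.X i) y =
        (emb p x - emb p y) * emb (MvPolynomial.X i) x +
          emb p y * (emb (MvPolynomial.X i) x - emb (MvPolynomial.X i) y) := by ring
    rw [h1, add_mul]
    refine (norm_add_le _ _).trans (add_le_add ?_ ?_)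
    · rw [norm_mul, (hX x y).2, mul_one]
      exact hC x y
    · rw [norm_mul]
      exact mul_le_mul ((emb p).norm_coe_le_norm y) (hX x y).1 (norm_nonneg _) (norm_nonneg _)

end Lipschitz

/-! ### Inverting the density: no zeros on the bicircle -/

section Density

variable {μ : Measure Torus} {p : Poly}

lemma integral_withDensity_inv (hne : ∀ x, emb p x ≠ 0)
    (h : μ = volume.withDensity (fun x => ENNReal.ofReal (1 / ‖emb p x‖ ^ 2)))
    (F : Torus → ℂ) :
    ∫ x, F x ∂μ = ∫ x, F x * (emb p x * starRingEnd ℂ (emb p x))⁻¹ := by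
  rw [h, integral_withDensity_eq_integral_toReal_smul]
  · congr 1
    ext x
    rw [ENNReal.toReal_ofReal (by positivity), Complex.mul_conj, Complex.normSq_eq_norm_sq,
      Complex.real_smul, mul_comm]
    push_cast
    rw [one_div]
  · exact (continuous_const.div ((emb p).continuous.norm.pow 2) fun x => by
      simpa using hne x).measurable.ennreal_ofReal
  · exact Filter.Eventually.of_forall fun x => ENNReal.ofReal_lt_top

variable [IsFiniteMeasure μ]

/-- Near a zero, |p|² ≤ C² r² on the ball of radius r, whose Lebesgue measure is at least r² for r ≤
1. Since |p|² dμ is Lebesgue measure, C² μ is at least 1 on every small punctured ball, yet these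
decrease to the empty set and μ is finite. -/
lemma emb_ne_zero_of_withDensity
    (h : μ.withDensity (fun x => ENNReal.ofReal (‖emb p x‖ ^ 2)) = volume) (x₀ : Torus) :
    emb p x₀ ≠ 0 := by
  intro h0
  obtain ⟨C, hC⟩ := exists_lipschitz_emb p
  have hC' : ∀ x, ‖emb p x‖ ≤ |C| * dist x x₀ := fun x => by
    have := hC x x₀
    rw [h0, sub_zero] at this
    exact this.trans (mul_le_mul_of_nonneg_right (le_abs_self C) dist_nonneg)
  -- The centre is removed because μ might have an atom there, invisible to |p|² dμ.
  set B : ℕ → Set Torus := fun k => Metric.closedBall x₀ (1 / (k + 1 : ℝ)) \ {x₀} with hB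
  have hBm : ∀ k, MeasurableSet (B k) := fun k =>
    measurableSet_closedBall.diff (measurableSet_singleton x₀)
  have hvol : ∀ k : ℕ, ENNReal.ofReal (1 / (k + 1 : ℝ) ^ 2) ≤
      ENNReal.ofReal (|C| ^ 2 * (1 / (k + 1 : ℝ) ^ 2)) * μ (B k) := by
    intro k
    have hk : (0 : ℝ) < k + 1 := by positivity
    have hk1 : 1 / (k + 1 : ℝ) ≤ 1 := by
      rw [div_le_one hk]
      linarith [Nat.cast_nonneg (α := ℝ) k]
    have h1 : (volume : Measure Torus) {x₀} = 0 := by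
      rw [← h, withDensity_apply _ (measurableSet_singleton x₀), lintegral_singleton, h0]
      simp
    have h2 : ENNReal.ofReal (1 / (k + 1 : ℝ) ^ 2) ≤
        (volume : Measure Torus) (Metric.closedBall x₀ (1 / (k + 1 : ℝ))) := by
      rw [← closedBall_prod_same, Measure.volume_eq_prod, Measure.prod_prod,
        AddCircle.volume_closedBall, AddCircle.volume_closedBall, ← ENNReal.ofReal_mul]
      · refine ENNReal.ofReal_le_ofReal ?_
        have h3 : 1 / (k + 1 : ℝ) ≤ min (2 * Real.pi) (2 * (1 / (k + 1 : ℝ))) := by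
          refine le_min ?_ ?_
          · linarith [Real.pi_gt_three]
          · linarith [show 0 < 1 / (k + 1 : ℝ) by positivity]
        calc 1 / (k + 1 : ℝ) ^ 2 = (1 / (k + 1 : ℝ)) * (1 / (k + 1 : ℝ)) := by field_simp
          _ ≤ _ := mul_le_mul h3 h3 (by positivity) (le_trans (by positivity) h3)
      · positivity
    refine h2.trans ?_
    have h4 : (volume : Measure Torus) (Metric.closedBall x₀ (1 / (k + 1 : ℝ))) ≤
        volume (B k) := by
      rw [hB]
      exact (measure_sdiff_null h1).ge
    refine h4.trans ?_
    conv_lhs => rw [← h]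
    rw [withDensity_apply _ (hBm k)]
    refine (setLIntegral_mono (g := fun _ => ENNReal.ofReal (|C| ^ 2 * (1 / (k + 1 : ℝ) ^ 2)))
      measurable_const fun x hx => ENNReal.ofReal_le_ofReal ?_).trans ?_
    · have hx1 : dist x x₀ ≤ 1 / (k + 1 : ℝ) := hx.1
      calc ‖emb p x‖ ^ 2 ≤ (|C| * (1 / (k + 1 : ℝ))) ^ 2 :=
            pow_le_pow_left₀ (norm_nonneg _)
              ((hC' x).trans (mul_le_mul_of_nonneg_left hx1 (abs_nonneg C))) 2
        _ = _ := by field_simp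
    · rw [setLIntegral_const]
  have hlow : ∀ k : ℕ, (1 : ENNReal) ≤ ENNReal.ofReal (|C| ^ 2) * μ (B k) := by
    intro k
    have hk : (0 : ℝ) < 1 / (k + 1 : ℝ) ^ 2 := by positivity
    have h1 := hvol k
    rw [ENNReal.ofReal_mul (by positivity), mul_right_comm] at h1
    have h2 : ENNReal.ofReal (1 / (k + 1 : ℝ) ^ 2) ≠ 0 :=
      (ENNReal.ofReal_pos.mpr hk).ne'
    rwa [← ENNReal.mul_le_mul_iff_left h2 ENNReal.ofReal_ne_top, one_mul]
  have hlim : Filter.Tendsto (fun k => μ (B k)) Filter.atTop (nhds (μ (⋂ k, B k))) := by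
    refine tendsto_measure_iInter_atTop (fun k => (hBm k).nullMeasurableSet) ?_
      ⟨0, measure_ne_top _ _⟩
    intro k l hkl
    refine Set.sdiff_subset_sdiff_left (Metric.closedBall_subset_closedBall ?_)
    exact one_div_le_one_div_of_le (by positivity) (by exact_mod_cast Nat.succ_le_succ hkl)
  have hempty : ⋂ k, B k = ∅ := by
    rw [Set.eq_empty_iff_forall_notMem]
    intro x hx
    rw [Set.mem_iInter] at hx
    have h1 : dist x x₀ ≤ 0 :=
      ge_of_tendsto' tendsto_one_div_add_atTop_nhds_zero_nat fun k => (hx k).1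
    exact (hx 0).2 (dist_le_zero.mp h1)
  rw [hempty, measure_empty] at hlim
  have hlim2 := ENNReal.Tendsto.const_mul (a := ENNReal.ofReal (|C| ^ 2)) hlim
    (Or.inr ENNReal.ofReal_ne_top)
  rw [mul_zero] at hlim2
  have := ge_of_tendsto' hlim2 hlow
  simp at this

lemma measurable_ofReal_norm_sq (p : Poly) :
    Measurable fun x => ENNReal.ofReal (‖emb p x‖ ^ 2) :=
  ((emb p).continuous.norm.pow 2).measurable.ennreal_ofReal

lemma eq_withDensity_of_withDensity_eq
    (h : μ.withDensity (fun x => ENNReal.ofReal (‖emb p x‖ ^ 2)) = volume) :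
    μ = volume.withDensity (fun x => ENNReal.ofReal (1 / ‖emb p x‖ ^ 2)) := by
  have hne := emb_ne_zero_of_withDensity h
  rw [← h]
  have h1 : (fun x => ENNReal.ofReal (1 / ‖emb p x‖ ^ 2)) =
      fun x => (ENNReal.ofReal (‖emb p x‖ ^ 2))⁻¹ := by
    ext x
    rw [one_div, ENNReal.ofReal_inv_of_pos]
    have := norm_pos_iff.mpr (hne x)
    positivity
  rw [h1, withDensity_inv_same (measurable_ofReal_norm_sq p)]
  · refine Filter.Eventually.of_forall fun x => ?_
    simpa using hne x
  · exact Filter.Eventually.of_forall fun x => ENNReal.ofReal_ne_top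

end Density

/-! ### From the orthogonality conditions to the Bernstein–Szegő measure -/

section Shift

variable {μ : Measure Torus}

/-- `f` has degree at most `(i, j)` and is orthogonal to all `z^a w^b`, `a ≤ i`, `b ≤ j`, except
possibly `z^i w^j`. -/
structure IsCorner (μ : Measure Torus) (i j : ℕ) (f : Poly) : Prop where
  mem : f ∈ V (i + 1) (j + 1)
  left : Orth μ f (V i (j + 1))
  right : Orth μ f (V (i + 1) j)

/-- Each instance of `KOrth` adds one more power of w, so the rectangle grows to arbitrary height.
-/
lemma IsCorner.orth_left {i j : ℕ} {f : Poly} (hf : IsCorner μ i j f)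
    (h : ∀ j', j < j' → KOrth μ i j') (N : ℕ) : Orth μ f (V i (j + 1 + N)) := by
  induction N with
  | zero => exact hf.left
  | succ N ih =>
    exact h (j + 1 + N) (by omega) f (V_mono le_rfl (by omega) hf.mem) ih

lemma IsCorner.orth_right {i j : ℕ} {f : Poly} (hf : IsCorner μ i j f)
    (h : ∀ i', i < i' → KOrth' μ i' j) (N : ℕ) : Orth μ f (V (i + 1 + N) j) := by
  induction N with
  | zero => exact hf.right
  | succ N ih =>
    exact h (i + 1 + N) (by omega) f (V_mono (by omega) le_rfl hf.mem) ih

variable [IsFiniteMeasure μ]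

/-- Monomials divisible by z reduce to those for `f` by cancelling z; the new column a = 0 is what
`EOrth` supplies. -/
lemma IsCorner.X0_mul {i j : ℕ} {f : Poly} (hf : IsCorner μ i j f) (h : EOrth μ i j) :
    IsCorner μ (i + 1) j (MvPolynomial.X 0 * f) where
  mem := by
    have := mono_mul_mem_V (k := 1) (l := 0) hf.mem
    rw [zero_add, add_comm 1 (i + 1)] at this
    simpa [mono] using this
  left := h f hf.mem hf.left
  right := by
    rw [orth_V]
    rintro (_ | a) ha b hb
    · exact h f hf.mem hf.left _ (mono_mem_V (by omega) (by omega))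
    · have h1 : mono (a + 1) b = MvPolynomial.X 0 * mono a b := by
        simp only [mono]
        ring
      rw [h1, ip_X0_mul]
      exact hf.right _ (mono_mem_V (by omega) hb)

lemma IsCorner.X1_mul {i j : ℕ} {f : Poly} (hf : IsCorner μ i j f) (h : EOrth' μ i j) :
    IsCorner μ i (j + 1) (MvPolynomial.X 1 * f) where
  mem := by
    have := mono_mul_mem_V (k := 0) (l := 1) hf.mem
    rw [zero_add, add_comm 1 (j + 1)] at this
    simpa [mono] using this
  left := by
    rw [orth_V]
    rintro a ha (_ | b) hb
    · exact h f hf.mem hf.right _ (mono_mem_V (by omega) (by omega))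
    · have h1 : mono a (b + 1) = MvPolynomial.X 1 * mono a b := by
        simp only [mono]
        ring
      rw [h1, ip_X1_mul]
      exact hf.left _ (mono_mem_V ha (by omega))
  right := h f hf.mem hf.right

/-- The mirrored condition is available only at i = n, so all multiplications by w come before those
by z. -/
lemma isCorner_mono_mul {n m : ℕ} {p : Poly} (hp : IsCorner μ n m p)
    (hE : ∀ i j, n ≤ i → m ≤ j → EOrth μ i j) (hE' : ∀ j, m ≤ j → EOrth' μ n j) (k l : ℕ) :
    IsCorner μ (n + k) (m + l) (mono k l * p) := by
  induction k with
  | zero =>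
    induction l with
    | zero => simpa [mono] using hp
    | succ l ih =>
      have := ih.X1_mul (hE' _ (by omega))
      have h1 : mono 0 (l + 1) = MvPolynomial.X 1 * mono 0 l := by
        simp only [mono]
        ring
      rw [h1, mul_assoc]
      exact this
  | succ k ih =>
    have := ih.X0_mul (hE _ _ (by omega) (by omega))
    have h1 : mono (k + 1) l = MvPolynomial.X 0 * mono k l := by
      simp only [mono]
      ring
    rw [h1, mul_assoc]
    exact this

/-- Multiplying both factors by z^k w^l makes the exponents nonnegative. The shifted polynomial is
still a corner, and the strip extension reaches the shifted character. -/
lemma intL_emb_mul_star_chi {n m : ℕ} {p : Poly}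
    (hc : ∀ k l, IsCorner μ (n + k) (m + l) (mono k l * p))
    (hK : ∀ i j, n ≤ i → m ≤ j → KOrth μ i j) (hK' : ∀ i j, n ≤ i → m ≤ j → KOrth' μ i j)
    {a b : ℤ} (hab : a < n ∨ b < m) : intL μ (emb p * star (chi a b)) = 0 := by
  set k := (-a).toNat with hk
  set l := (-b).toNat with hl
  obtain ⟨a', ha'⟩ := Int.eq_ofNat_of_zero_le (show 0 ≤ a + k by omega)
  obtain ⟨b', hb'⟩ := Int.eq_ofNat_of_zero_le (show 0 ≤ b + l by omega)
  have h1 : ip μ (mono k l * p) (mono a' b') = 0 := by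
    rcases hab with h | h
    · exact (hc k l).orth_left (fun j' hj' => hK _ _ (by omega) (by omega)) (b' + 1) _
        (mono_mem_V (by omega) (by omega))
    · exact (hc k l).orth_right (fun j' hj' => hK' _ _ (by omega) (by omega)) (a' + 1) _
        (mono_mem_V (by omega) (by omega))
  rw [ip_eq_intL, map_mul emb, emb_mono, emb_mono, ← ha', ← hb', star_chi] at h1
  have h2 : chi k l * emb p * chi (-(a + k)) (-(b + l)) = emb p * star (chi a b) := by
    rw [mul_comm (chi _ _), mul_assoc, chi_mul, star_chi]
    congr 2 <;> ring
  rw [h2] at h1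
  simpa [Real.pi_ne_zero] using h1

lemma intL_star (F : C(Torus, ℂ)) : intL μ (star F) = starRingEnd ℂ (intL μ F) := by
  rw [intL_apply, intL_apply, ← integral_conj]
  rfl

/-- If a > 0 or b > 0, expanding p̄ pairs `p` only with characters z^{c-a} w^{d-b} having c - a < n
or d - b < m. The remaining exponents follow by conjugation, |p|² being real. -/
lemma intL_chi_mul_normSq {n m : ℕ} {p : Poly} (hp : p ∈ V (n + 1) (m + 1))
    (h : ∀ a b : ℤ, a < n ∨ b < m → intL μ (emb p * star (chi a b)) = 0)
    {a b : ℤ} (hab : a ≠ 0 ∨ b ≠ 0) : intL μ (chi a b * (emb p * star (emb p))) = 0 := by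
  have key : ∀ a b : ℤ, 0 < a ∨ 0 < b → intL μ (chi a b * (emb p * star (emb p))) = 0 := by
    intro a b hab
    have h1 : star (emb p) = ∑ c ∈ Finset.range (n + 1), ∑ d ∈ Finset.range (m + 1),
        starRingEnd ℂ (coeffAt p c d) • star (chi c d) := by
      conv_lhs => rw [eq_sum_of_mem_V hp]
      simp only [map_sum, map_smul, emb_mono, star_sum, star_smul]
      rfl
    rw [h1]
    simp only [Finset.mul_sum, map_sum, mul_smul_comm, map_smul]
    refine Finset.sum_eq_zero fun c hc => Finset.sum_eq_zero fun d hd => ?_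
    rw [Finset.mem_range] at hc hd
    have h2 : chi a b * (emb p * star (chi c d)) = emb p * star (chi (c - a) (d - b)) := by
      rw [mul_left_comm, star_chi, star_chi, chi_mul]
      congr 2 <;> ring
    rw [h2, h _ _ (by omega), smul_zero]
  by_cases h0 : 0 < a ∨ 0 < b
  · exact key a b h0
  · have h1 : chi a b * (emb p * star (emb p)) =
        star (chi (-a) (-b) * (emb p * star (emb p))) := by
      rw [star_mul', star_mul', star_star, star_chi, neg_neg, neg_neg, mul_comm (emb p)]
    rw [h1, intL_star, key _ _ (by omega), map_zero]

lemma withDensity_normSq_eq_volume {p : Poly} (hp : ip μ p p = 1)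
    (h : ∀ a b : ℤ, a ≠ 0 ∨ b ≠ 0 → intL μ (chi a b * (emb p * star (emb p))) = 0) :
    μ.withDensity (fun x => ENNReal.ofReal (‖emb p x‖ ^ 2)) = volume := by
  have hfin : IsFiniteMeasure (μ.withDensity (fun x => ENNReal.ofReal (‖emb p x‖ ^ 2))) := by
    refine isFiniteMeasure_withDensity_ofReal ?_
    exact (((emb p).continuous.norm.pow 2).integrable_of_hasCompactSupport
      (HasCompactSupport.of_compactSpace _)).2
  refine measure_ext_of_chi fun a b => ?_
  have h1 : ∫ x, chi a b x ∂(μ.withDensity (fun x => ENNReal.ofReal (‖emb p x‖ ^ 2))) =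
      intL μ (chi a b * (emb p * star (emb p))) := by
    rw [integral_withDensity_eq_integral_toReal_smul (measurable_ofReal_norm_sq p)
      (Filter.Eventually.of_forall fun x => ENNReal.ofReal_lt_top), intL_apply]
    congr 1
    ext x
    rw [ENNReal.toReal_ofReal (by positivity), Complex.real_smul, mul_comm]
    simp only [ContinuousMap.mul_apply, ContinuousMap.star_apply, RCLike.star_def,
      Complex.mul_conj, Complex.normSq_eq_norm_sq]
  rw [h1, integral_chi]
  split_ifs with h0
  · rw [h0.1, h0.2, chi_zero, one_mul]
    rw [ip_eq_intL] at hp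
    have : (Real.pi : ℂ) ≠ 0 := by exact_mod_cast Real.pi_ne_zero
    field_simp at hp
    rw [hp]
    ring
  · exact h a b (by tauto)

lemma isCorner_phi (hμ : PosDefinite μ) (n m : ℕ) : IsCorner μ n m (phi μ n m m) where
  mem := phi_mem hμ le_rfl
  left := phi_orth hμ n m m
  right := by
    rw [orth_V]
    intro a ha b hb
    -- All z^a w^b with a ≤ n and b < m precede z^n w^m in the lexicographical order, the column a =
    -- n included.
    refine orthonormalize_orth hμ (linearIndependent_lex m) le_rfl _
      (Submodule.subset_span ⟨b + (m + 1) * a, ?_, ?_⟩)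
    · rw [Set.mem_Iio]
      nlinarith
    · simp [Nat.add_mul_div_left, Nat.add_mul_mod_self_left,
        Nat.div_eq_of_lt (show b < m + 1 by omega), Nat.mod_eq_of_lt (show b < m + 1 by omega)]

lemma coeffAt_phi_ne_zero (hμ : PosDefinite μ) (n m : ℕ) : coeffAt (phi μ n m m) n m ≠ 0 := by
  obtain ⟨-, -, c, hc, r, hr, h⟩ :=
    orthonormalize_spec hμ (linearIndependent_lex m) (n * (m + 1) + m)
  have h1 : coeffAt r n m = 0 := by
    have : Submodule.span ℂ ((fun k : ℕ => mono (k / (m + 1)) (k % (m + 1))) ''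
        Set.Iio (n * (m + 1) + m)) ≤ LinearMap.ker
          (MvPolynomial.lcoeff ℂ (Finsupp.single 0 n + Finsupp.single 1 m : Fin 2 →₀ ℕ)) := by
      refine Submodule.span_le.mpr ?_
      rintro _ ⟨k, hk, rfl⟩
      have h2 := coeffAt_mono (k / (m + 1)) (k % (m + 1)) n m
      rw [if_neg] at h2
      · exact h2
      · rintro ⟨h3, h4⟩
        have := Nat.div_add_mod k (m + 1)
        rw [h3, h4, mul_comm] at this
        rw [Set.mem_Iio] at hk
        omega
    exact this hr
  have h3 : (n * (m + 1) + m) / (m + 1) = n := by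
    rw [add_comm, mul_comm, Nat.add_mul_div_left _ _ (by omega), Nat.div_eq_of_lt (by omega),
      zero_add]
  have h4 : (n * (m + 1) + m) % (m + 1) = m := by
    rw [add_comm, mul_comm, Nat.add_mul_mod_self_left, Nat.mod_eq_of_lt (by omega)]
  have h5 : coeffAt (phi μ n m m) n m = c * (coeffAt (mono n m) n m - coeffAt r n m) := by
    rw [phi, h, h3, h4]
    simp only [coeffAt, MvPolynomial.coeff_smul, MvPolynomial.coeff_sub, smul_eq_mul]
  rw [h5, h1, coeffAt_mono]
  simpa using hc.ne'

/-- Against the density 1/(p p̄) the factor `p` cancels, and z^n w^m p̄ is the reverse. The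
orthogonality relations thus become the vanishing of the moments in `IsBiPoly.ne_zero`. -/
lemma isStable_reverse {n m : ℕ} {p : Poly} (hp : p ∈ V (n + 1) (m + 1))
    (hne : ∀ x, emb p x ≠ 0)
    (hμ : μ = volume.withDensity (fun x => ENNReal.ofReal (1 / ‖emb p x‖ ^ 2)))
    (h : ∀ a b : ℤ, a < n ∨ b < m → intL μ (emb p * star (chi a b)) = 0) :
    IsStable (reverse n m p) := by
  have hq : ∀ t s, evalAt (reverse n m p) (circ t) (circ s) =
      chi n m (t, s) * starRingEnd ℂ (emb p (t, s)) := by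
    intro t s
    have := DFunLike.congr_fun (emb_reverse hp) (t, s)
    rw [emb_apply] at this
    exact this
  have hchi : ∀ a b x, chi a b x ≠ 0 := fun a b x =>
    mul_ne_zero (zpow_ne_zero _ (circ_ne_zero _)) (zpow_ne_zero _ (circ_ne_zero _))
  intro z w hz hw
  refine (isBiPoly_evalAt (reverse n m p)).ne_zero (fun t s => ?_) (fun a b hab => ?_) hz hw
  · rw [hq]
    exact mul_ne_zero (hchi _ _ _) (by simpa using hne (t, s))
  · have h1 := h (n - a) (m - b) (by omega)
    rw [intL_apply, integral_withDensity_inv hne hμ] at h1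
    rw [← h1]
    congr 1
    ext x
    have h2 := hq x.1 x.2
    rw [Prod.mk.eta] at h2
    have h3 : star (chi (n - a) (m - b)) * chi n m = chi a b := by
      rw [star_chi, chi_mul]
      congr 1 <;> ring
    have h4 := DFunLike.congr_fun h3 x
    rw [ContinuousMap.mul_apply] at h4
    rw [h2, ContinuousMap.mul_apply, ← h4]
    have h5 := hne x
    have h6 : starRingEnd ℂ (emb p x) ≠ 0 := by simpa using h5
    have h7 := hchi n m x
    field_simp

theorem bernsteinSzego_of_orthogonality (hμ : PosDefinite μ) {n m : ℕ}
    (h : ∀ i j : ℕ, n ≤ i → m ≤ j →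
      calK μ i j = 0 ∧ EhatSucc μ i j = 0 ∧ EhatTildeSucc μ n j = 0) :
    μ.AbsolutelyContinuous volume ∧ ∃ p : Poly, HasBidegree n m p ∧ IsStable (reverse n m p) ∧
      μ = volume.withDensity (fun x => ENNReal.ofReal (1 / ‖onTorus p x‖ ^ 2)) := by
  have hc := isCorner_mono_mul (isCorner_phi hμ n m)
    (fun i j hi hj => EOrth_of_EhatSucc hμ (h i j hi hj).2.1)
    (fun j hj => EOrth'_of_EhatTildeSucc hμ (h n j le_rfl hj).2.2)
  have hz := fun a b => intL_emb_mul_star_chi hc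
    (fun i j hi hj => KOrth_of_calK hμ (h i j hi hj).1)
    (fun i j hi hj => KOrth'_of_calK hμ (h i j hi hj).1) (a := a) (b := b)
  have hd := withDensity_normSq_eq_volume (p := phi μ n m m)
    (orthonormalize_spec hμ (linearIndependent_lex m) (n * (m + 1) + m)).2.1
    fun a b => intL_chi_mul_normSq (isCorner_phi hμ n m).mem hz
  have hμ' := eq_withDensity_of_withDensity_eq hd
  refine ⟨?_, phi μ n m m, ?_, ?_, ?_⟩
  · rw [hμ']
    exact withDensity_absolutelyContinuous _ _
  · have := degreeOf_le_of_mem_V (isCorner_phi hμ n m).mem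
    exact ⟨this.1, this.2, coeffAt_phi_ne_zero hμ n m⟩
  · exact isStable_reverse (isCorner_phi hμ n m).mem (emb_ne_zero_of_withDensity hd) hμ' hz
  · simpa only [emb_apply] using hμ'

end Shift

/-! ### Bounded solutions of linear recurrences -/

section BoundedShift

/-- The left shift of sequences. -/
def shift : (ℕ → ℂ) →ₗ[ℂ] (ℕ → ℂ) := LinearMap.funLeft ℂ ℂ Nat.succ

lemma shift_apply (η : ℕ → ℂ) (k : ℕ) : shift η k = η (k + 1) := rfl

lemma shift_pow_apply (s : ℕ) (η : ℕ → ℂ) (k : ℕ) : (shift ^ s) η k = η (k + s) := by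
  induction s generalizing k with
  | zero => simp
  | succ s ih => rw [pow_succ', Module.End.mul_apply, shift_apply, ih]; congr 1; ring

/-- Split off a root α, which has |α| > 1. By induction the other factor is injective on bounded
sequences, so η is geometric with ratio α, and boundedness forces it to vanish. -/
lemma eq_zero_of_aeval_shift {Q : Polynomial ℂ} (hQ : ∀ z, ‖z‖ ≤ 1 → Q.eval z ≠ 0)
    {η : ℕ → ℂ} {C : ℝ} (hη : ∀ k, ‖η k‖ ≤ C) (h : Polynomial.aeval shift Q η = 0) : η = 0 := by
  induction hd : Q.natDegree generalizing Q η C with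
  | zero =>
    rw [Polynomial.eq_C_of_natDegree_eq_zero hd] at h hQ
    have hc := hQ 0 (by simp)
    rw [Polynomial.eval_C] at hc
    rw [Polynomial.aeval_C, Module.algebraMap_end_apply] at h
    exact (smul_eq_zero.mp h).resolve_left hc
  | succ d ih =>
    obtain ⟨α, hα⟩ := IsAlgClosed.exists_root Q
      (Polynomial.degree_ne_of_natDegree_ne (by rw [hd]; exact Nat.succ_ne_zero d))
    obtain ⟨R, rfl⟩ := Polynomial.dvd_iff_isRoot.mpr hα
    have hα1 : 1 < ‖α‖ := by
      by_contra hle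
      exact hQ α (not_lt.mp hle) hα
    have hR : ∀ z, ‖z‖ ≤ 1 → R.eval z ≠ 0 := fun z hz h0 => hQ z hz (by simp [h0])
    have hR0 : R ≠ 0 := by
      rintro rfl
      simp at hd
    rw [mul_comm, map_mul, Module.End.mul_apply] at h
    have hdeg : R.natDegree = d := by
      rw [Polynomial.natDegree_mul (Polynomial.X_sub_C_ne_zero α) hR0,
        Polynomial.natDegree_X_sub_C] at hd
      omega
    have h1 : ∀ k, Polynomial.aeval shift (Polynomial.X - Polynomial.C α) η k =
        η (k + 1) - α * η k := fun k => by
      simp [shift_apply, Module.algebraMap_end_apply]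
    have h2 : Polynomial.aeval shift (Polynomial.X - Polynomial.C α) η = 0 := by
      refine ih (C := C + ‖α‖ * C) hR (fun k => ?_) h hdeg
      rw [h1]
      refine (norm_sub_le _ _).trans (add_le_add (hη _) ?_)
      rw [norm_mul]
      exact mul_le_mul_of_nonneg_left (hη k) (norm_nonneg _)
    have h3 : ∀ k, η (k + 1) = α * η k := fun k => by
      rw [← sub_eq_zero, ← h1, h2, Pi.zero_apply]
    have h4 : ∀ k l, η (k + l) = α ^ l * η k := by
      intro k l
      induction l with
      | zero => simp
      | succ l ihl => rw [← add_assoc, h3, ihl, pow_succ]; ring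
    ext k
    by_contra hk
    have hk' : 0 < ‖η k‖ := norm_pos_iff.mpr hk
    obtain ⟨l, hl⟩ := pow_unbounded_of_one_lt (C / ‖η k‖) hα1
    have h5 := hη (k + l)
    rw [h4, norm_mul, norm_pow] at h5
    rw [div_lt_iff₀ hk'] at hl
    linarith

end BoundedShift

/-! ### The Gohberg–Semencul dual system on a strip -/

/-- The systems of characters `z^a w^b` and `z^b w^a` share these properties. -/
structure IsCharSystem (e : ℤ → ℤ → C(Torus, ℂ)) : Prop where
  one : e 0 0 = 1
  mul : ∀ a b c d, e a b * e c d = e (a + c) (b + d)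
  star : ∀ a b, Star.star (e a b) = e (-a) (-b)
  integral : ∀ a b,
    intL volume (e a b) = if a = 0 ∧ b = 0 then (2 * Real.pi : ℂ) ^ 2 else 0
  ext : ∀ L L' : C(Torus, ℂ) →L[ℂ] ℂ, (∀ a b, L (e a b) = L' (e a b)) → L = L'

lemma isCharSystem_chi : IsCharSystem chi :=
  ⟨chi_zero, chi_mul, star_chi, integral_chi, fun _ _ => eq_of_eq_on_chi⟩

lemma IsCharSystem.symm {e : ℤ → ℤ → C(Torus, ℂ)} (h : IsCharSystem e) :
    IsCharSystem fun a b => e b a :=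
  ⟨h.one, fun _ _ _ _ => h.mul _ _ _ _, fun _ _ => h.star _ _,
    fun a b => by rw [h.integral]; simp only [and_comm], fun L L' hL => h.ext L L' fun a b => hL b a⟩

/-- The measure `|q|⁻² dθ dφ` for `q = ∑ k_{s,t} e_{s,t}`, `s ≤ n`, `t ≤ m`, where the Fourier
coefficients of `1/q` are supported in the first quadrant. -/
structure IsBernsteinSzego (e : ℤ → ℤ → C(Torus, ℂ)) (n m : ℕ) (k : ℕ × ℕ → ℂ)
    (q r : C(Torus, ℂ)) (μ : Measure Torus) [IsFiniteMeasure μ] : Prop where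
  char : IsCharSystem e
  eq_sum : q = ∑ s ∈ Finset.range (n + 1) ×ˢ Finset.range (m + 1), k s • e s.1 s.2
  mul_inv : q * r = 1
  inv_coeff : ∀ a b : ℤ, 1 ≤ a ∨ 1 ≤ b → intL volume (e a b * r) = 0
  intL_eq : ∀ F, intL μ F = intL volume (F * (r * star r))

section Dual

variable {e : ℤ → ℤ → C(Torus, ℂ)} {n m : ℕ} {k : ℕ × ℕ → ℂ} {q r : C(Torus, ℂ)}
  {μ : Measure Torus} [IsFiniteMeasure μ]

/-- The span of the characters with exponents in `S`. -/
def trigSpan (e : ℤ → ℤ → C(Torus, ℂ)) (S : Set (ℤ × ℤ)) : Submodule ℂ C(Torus, ℂ) :=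
  Submodule.span ℂ ((fun s => e s.1 s.2) '' S)

lemma mem_trigSpan {S : Set (ℤ × ℤ)} {a b : ℤ} (h : (a, b) ∈ S) : e a b ∈ trigSpan e S :=
  Submodule.subset_span ⟨(a, b), h, rfl⟩

lemma intL_mul_eq_zero_of_mem_trigSpan {S : Set (ℤ × ℤ)} {G f : C(Torus, ℂ)}
    (hf : f ∈ trigSpan e S) (h : ∀ a b, (a, b) ∈ S → intL μ (e a b * G) = 0) :
    intL μ (f * G) = 0 := by
  have : trigSpan e S ≤
      LinearMap.ker ((intL μ : C(Torus, ℂ) →ₗ[ℂ] ℂ).comp (LinearMap.mulRight ℂ G)) := by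
    refine Submodule.span_le.mpr ?_
    rintro _ ⟨⟨a, b⟩, hs, rfl⟩
    exact h a b hs
  exact this hf

/-- `w^c q̄` truncated to the nonnegative powers of `w`. -/
def truncNonneg (e : ℤ → ℤ → C(Torus, ℂ)) (n m : ℕ) (k : ℕ × ℕ → ℂ) (c : ℤ) : C(Torus, ℂ) :=
  ∑ s ∈ Finset.range (n + 1) ×ˢ Finset.range (m + 1),
    (if (s.2 : ℤ) ≤ c then starRingEnd ℂ (k s) else 0) • e (-s.1) (c - s.2)

/-- `w^c q` truncated to the powers of `w` that are at least `J`. -/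
def truncGe (e : ℤ → ℤ → C(Torus, ℂ)) (n m : ℕ) (k : ℕ × ℕ → ℂ) (J c : ℤ) : C(Torus, ℂ) :=
  ∑ s ∈ Finset.range (n + 1) ×ˢ Finset.range (m + 1),
    (if J ≤ c + s.2 then k s else 0) • e s.1 (c + s.2)

/-- The system dual to `1, w, …, w^{J-1}` over the Laurent polynomials in `z`, as given by the
Gohberg–Semencul formula. -/
def dual (e : ℤ → ℤ → C(Torus, ℂ)) (n m : ℕ) (k : ℕ × ℕ → ℂ) (q : C(Torus, ℂ)) (J c : ℤ) :
    C(Torus, ℂ) :=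
  q * truncNonneg e n m k c - star q * truncGe e n m k J c

lemma intL_volume_star (F : C(Torus, ℂ)) :
    intL volume (star F) = starRingEnd ℂ (intL volume F) := intL_star F

namespace IsBernsteinSzego

variable (h : IsBernsteinSzego e n m k q r μ)

include h

lemma star_eq_sum : star q = ∑ s ∈ Finset.range (n + 1) ×ˢ Finset.range (m + 1),
    starRingEnd ℂ (k s) • e (-s.1) (-s.2) := by
  rw [h.eq_sum, star_sum]
  refine Finset.sum_congr rfl fun s _ => ?_
  rw [star_smul, h.char.star]
  rfl

lemma star_mul_inv : star q * star r = 1 := by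
  rw [← star_mul', h.mul_inv, star_one]

lemma star_inv_coeff {a b : ℤ} (hab : a ≤ -1 ∨ b ≤ -1) : intL volume (e a b * star r) = 0 := by
  have h1 : e a b * star r = star (e (-a) (-b) * r) := by
    rw [star_mul', h.char.star, neg_neg, neg_neg]
  rw [h1, intL_volume_star, h.inv_coeff _ _ (by omega), map_zero]

/-- In the double sum over the coefficients of q̄ and q, the terms where both or neither truncation
condition holds cancel. In the survivors the w-exponent c + t - s lies in [0, J), by m ≤ J. -/
lemma dual_mem {J : ℤ} (hJ : m ≤ J) (c : ℤ) :
    dual e n m k q J c ∈ trigSpan e {s | -n ≤ s.1 ∧ s.1 ≤ n ∧ 0 ≤ s.2 ∧ s.2 < J} := by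
  have h1 : dual e n m k q J c = ∑ s ∈ Finset.range (n + 1) ×ˢ Finset.range (m + 1),
      ∑ t ∈ Finset.range (n + 1) ×ˢ Finset.range (m + 1),
      (((if (s.2 : ℤ) ≤ c then 1 else 0) - (if J ≤ c + t.2 then 1 else 0)) *
        (k t * starRingEnd ℂ (k s))) • e (t.1 - s.1) (c + t.2 - s.2) := by
    rw [dual, h.star_eq_sum]
    conv_lhs => rw [h.eq_sum]
    rw [truncNonneg, truncGe, Finset.sum_mul_sum, Finset.sum_mul_sum, Finset.sum_comm,
      ← Finset.sum_sub_distrib]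
    refine Finset.sum_congr rfl fun s _ => ?_
    rw [← Finset.sum_sub_distrib]
    refine Finset.sum_congr rfl fun t _ => ?_
    rw [smul_mul_smul_comm, smul_mul_smul_comm, h.char.mul, h.char.mul,
      show (t.1 : ℤ) + -s.1 = t.1 - s.1 by ring, show -(s.1 : ℤ) + t.1 = t.1 - s.1 by ring,
      show (t.2 : ℤ) + (c - s.2) = c + t.2 - s.2 by ring,
      show -(s.2 : ℤ) + (c + t.2) = c + t.2 - s.2 by ring, ← sub_smul]
    congr 1
    split_ifs <;> ring
  rw [h1]
  refine Submodule.sum_mem _ fun s hs => Submodule.sum_mem _ fun t ht => ?_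
  rw [Finset.mem_product, Finset.mem_range, Finset.mem_range] at hs ht
  by_cases h2 : (s.2 : ℤ) ≤ c ↔ J ≤ c + t.2
  · simp [h2]
  · refine Submodule.smul_mem _ _ (mem_trigSpan ?_)
    simp only [Set.mem_ofPred_eq]
    omega

lemma shift_dual_mem {J a : ℤ} (hJ : m ≤ J) (ha : n ≤ a) (c : ℤ) :
    e a 0 * dual e n m k q J c ∈ trigSpan e {s | 0 ≤ s.1 ∧ 0 ≤ s.2 ∧ s.2 < J} := by
  have : trigSpan e {s | -n ≤ s.1 ∧ s.1 ≤ n ∧ 0 ≤ s.2 ∧ s.2 < J} ≤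
      (trigSpan e {s | 0 ≤ s.1 ∧ 0 ≤ s.2 ∧ s.2 < J}).comap (LinearMap.mulLeft ℂ (e a 0)) := by
    refine Submodule.span_le.mpr ?_
    rintro _ ⟨s, hs, rfl⟩
    rw [SetLike.mem_coe, Submodule.mem_comap, LinearMap.mulLeft_apply, h.char.mul]
    refine mem_trigSpan ?_
    simp only [Set.mem_ofPred_eq] at hs ⊢
    omega
  exact this (h.dual_mem hJ c)

/-- Divided by |q|², the dual element is w^c minus two error terms: negative powers of w times 1/q̄,
and powers at least J times 1/q. Neither has a Fourier coefficient at w-exponent d in [0, J). -/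
lemma intL_dual {J c : ℤ} (a : ℤ) {d : ℤ} (hd : 0 ≤ d) (hdJ : d < J) :
    intL μ (dual e n m k q J c * star (e a d)) =
      if a = 0 ∧ c = d then (2 * Real.pi : ℂ) ^ 2 else 0 := by
  set A' : C(Torus, ℂ) := ∑ s ∈ Finset.range (n + 1) ×ˢ Finset.range (m + 1),
    (if (s.2 : ℤ) ≤ c then 0 else starRingEnd ℂ (k s)) • e (-s.1) (c - s.2) with hA'
  have hA : truncNonneg e n m k c = e 0 c * star q - A' := by
    rw [eq_sub_iff_add_eq, hA', truncNonneg, h.star_eq_sum, Finset.mul_sum,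
      ← Finset.sum_add_distrib]
    refine Finset.sum_congr rfl fun s _ => ?_
    rw [← add_smul, mul_smul_comm, h.char.mul, zero_add, ← sub_eq_add_neg]
    congr 1
    split_ifs <;> simp
  have h1 : dual e n m k q J c * star (e a d) * (r * star r) =
      e (-a) (c - d) - A' * e (-a) (-d) * star r -
        truncGe e n m k J c * e (-a) (-d) * r := by
    have h2 : e (-a) (c - d) = e 0 c * e (-a) (-d) := by
      rw [h.char.mul, zero_add, sub_eq_add_neg]
    rw [dual, hA, h.char.star, h2]
    linear_combination (e 0 c * star q - A') * e (-a) (-d) * star r * h.mul_inv +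
      (e 0 c * e (-a) (-d) - truncGe e n m k J c * e (-a) (-d) * r) * h.star_mul_inv
  have h3 : intL volume (A' * e (-a) (-d) * star r) = 0 := by
    rw [hA', Finset.sum_mul, Finset.sum_mul, map_sum]
    refine Finset.sum_eq_zero fun s _ => ?_
    split_ifs with hs
    · simp
    · rw [smul_mul_assoc, smul_mul_assoc, map_smul, h.char.mul, h.star_inv_coeff (by omega),
        smul_zero]
  have h4 : intL volume (truncGe e n m k J c * e (-a) (-d) * r) = 0 := by
    rw [truncGe, Finset.sum_mul, Finset.sum_mul, map_sum]
    refine Finset.sum_eq_zero fun s _ => ?_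
    split_ifs with hs
    · rw [smul_mul_assoc, smul_mul_assoc, map_smul, h.char.mul, h.inv_coeff _ _ (by omega),
        smul_zero]
    · simp
  rw [h.intL_eq, h1, map_sub, map_sub, h3, h4, h.char.integral, sub_zero, sub_zero]
  congr 1
  simp [sub_eq_zero]

lemma intL_star_shift_dual {J a c : ℤ} (a' : ℤ) {d : ℤ} (hd : 0 ≤ d) (hdJ : d < J) :
    intL μ (e a' d * star (e a 0 * dual e n m k q J c)) =
      if a' = a ∧ d = c then (2 * Real.pi : ℂ) ^ 2 else 0 := by
  have h1 : e a' d * star (e a 0 * dual e n m k q J c) =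
      star (dual e n m k q J c * star (e (a' - a) d)) := by
    have h2 : e a' d * e (-a) (-0) = e (a' - a) d := by
      rw [h.char.mul, neg_zero, add_zero, sub_eq_add_neg]
    rw [star_mul', star_mul', star_star, h.char.star, ← mul_assoc, h2,
      mul_comm (star (dual e n m k q J c))]
  rw [h1, intL_star, h.intL_dual _ hd hdJ]
  split_ifs with h2 h3 h3
  · simp [map_ofNat]
  · omega
  · omega
  · exact map_zero _

end IsBernsteinSzego

end Dual

/-! ### Extending orthogonality beyond the rectangle -/

section Extrapolation

variable {e : ℤ → ℤ → C(Torus, ℂ)} {n m : ℕ} {k : ℕ × ℕ → ℂ} {q r : C(Torus, ℂ)}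
  {μ : Measure Torus} [IsFiniteMeasure μ]

/-- A continuous function as an element of `L²(μ)`. -/
def embL2 (μ : Measure Torus) [IsFiniteMeasure μ] : C(Torus, ℂ) →L[ℂ] Lp ℂ 2 μ :=
  ContinuousMap.toLp 2 μ ℂ

lemma inner_embL2 (F G : C(Torus, ℂ)) :
    inner ℂ (embL2 μ F) (embL2 μ G) = intL μ (G * star F) := by
  rw [embL2, ContinuousMap.inner_toLp]
  rfl

lemma eq_zero_of_inner_embL2 {v : Lp ℂ 2 μ} (h : ∀ F, inner ℂ v (embL2 μ F) = 0) : v = 0 := by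
  have hd : DenseRange (embL2 μ) := ContinuousMap.toLp_denseRange ℂ μ ℂ (by norm_num)
  exact hd.eq_zero_of_inner_left ℂ h

/-- The closed span in `L²(μ)` of the characters with exponents in `S`. -/
def closedTrigSpan (e : ℤ → ℤ → C(Torus, ℂ)) (μ : Measure Torus) [IsFiniteMeasure μ]
    (S : Set (ℤ × ℤ)) : Submodule ℂ (Lp ℂ 2 μ) :=
  ((trigSpan e S).map (embL2 μ : C(Torus, ℂ) →ₗ[ℂ] Lp ℂ 2 μ)).topologicalClosure

lemma embL2_mem {S : Set (ℤ × ℤ)} {f : C(Torus, ℂ)} (hf : f ∈ trigSpan e S) :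
    embL2 μ f ∈ closedTrigSpan e μ S :=
  Submodule.le_topologicalClosure _ (Submodule.mem_map_of_mem hf)

lemma inner_eq_zero_of_mem_closedTrigSpan {S : Set (ℤ × ℤ)} {G : C(Torus, ℂ)}
    (h : ∀ a b, (a, b) ∈ S → intL μ (e a b * star G) = 0) {v : Lp ℂ 2 μ}
    (hv : v ∈ closedTrigSpan e μ S) : inner ℂ (embL2 μ G) v = 0 := by
  have : closedTrigSpan e μ S ≤ LinearMap.ker (innerSL ℂ (embL2 μ G) : Lp ℂ 2 μ →ₗ[ℂ] ℂ) := by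
    refine Submodule.topologicalClosure_minimal _ ?_ ?_
    · rintro _ ⟨f, hf, rfl⟩
      change inner ℂ (embL2 μ G) (embL2 μ f) = 0
      rw [inner_embL2]
      exact intL_mul_eq_zero_of_mem_trigSpan hf h
    · exact ContinuousLinearMap.isClosed_ker _
  exact this hv

namespace IsBernsteinSzego

variable (h : IsBernsteinSzego e n m k q r μ)

include h

/-- The functions z^a w^b |q|² are biorthogonal to all characters. Inside the half strip they differ
from the shifted duals by something orthogonal to its closed span; outside they are themselves
orthogonal to it. So `v` is orthogonal to all of them, and since |q|² is invertible these span a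
dense subspace. -/
lemma eq_zero_of_inner_dual {J : ℤ} {v : Lp ℂ 2 μ}
    (hv : v ∈ closedTrigSpan e μ {s | 0 ≤ s.1 ∧ 0 ≤ s.2 ∧ s.2 < J})
    (h0 : ∀ a d : ℤ, 0 ≤ a → 0 ≤ d → d < J →
      inner ℂ (embL2 μ (e a 0 * dual e n m k q J d)) v = 0) : v = 0 := by
  have hL : ∀ a b a' b' : ℤ, intL μ (e a' b' * star (e a b * (q * star q))) =
      if a' = a ∧ b' = b then (2 * Real.pi : ℂ) ^ 2 else 0 := by
    intro a b a' b'
    have h1 : e a' b' * star (e a b * (q * star q)) * (r * star r) = e (a' - a) (b' - b) := by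
      have h2 : e (a' - a) (b' - b) = e a' b' * e (-a) (-b) := by
        rw [h.char.mul, sub_eq_add_neg, sub_eq_add_neg]
      rw [star_mul', star_mul', star_star, h.char.star, h2]
      linear_combination e a' b' * e (-a) (-b) * star q * star r * h.mul_inv +
        e a' b' * e (-a) (-b) * h.star_mul_inv
    rw [h.intL_eq, h1, h.char.integral]
    simp only [sub_eq_zero]
  have h1 : ∀ a b, inner ℂ (embL2 μ (e a b * (q * star q))) v = 0 := by
    intro a b
    by_cases hab : 0 ≤ a ∧ 0 ≤ b ∧ b < J
    · have h2 : inner ℂ (embL2 μ (e a b * (q * star q) - e a 0 * dual e n m k q J b)) v = 0 := by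
        refine inner_eq_zero_of_mem_closedTrigSpan (fun a' b' hs => ?_) hv
        rw [Set.mem_ofPred_eq] at hs
        rw [star_sub, mul_sub, map_sub, hL, h.intL_star_shift_dual _ hs.2.1 hs.2.2, sub_self]
      rw [map_sub, inner_sub_left, h0 a b hab.1 hab.2.1 hab.2.2, sub_zero] at h2
      exact h2
    · refine inner_eq_zero_of_mem_closedTrigSpan (fun a' b' hs => ?_) hv
      rw [Set.mem_ofPred_eq] at hs
      rw [hL, if_neg (by rintro ⟨rfl, rfl⟩; exact hab hs)]
  have h2 : ((innerSL ℂ v).comp (embL2 μ)).comp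
      (ContinuousLinearMap.mul ℂ C(Torus, ℂ) (q * star q)) = 0 := by
    refine h.char.ext _ _ fun a b => ?_
    change inner ℂ v (embL2 μ (q * star q * e a b)) = 0
    rw [mul_comm (q * star q), ← inner_conj_symm, h1, map_zero]
  refine eq_zero_of_inner_embL2 fun F => ?_
  have h3 := DFunLike.congr_fun h2 (r * star r * F)
  change inner ℂ v (embL2 μ (q * star q * (r * star r * F))) = 0 at h3
  rwa [show q * star q * (r * star r * F) = F by
    linear_combination star q * star r * F * h.mul_inv + F * h.star_mul_inv] at h3

/-- Project z^a w^d, a < 0, onto the closed span of the half strip. Shifted duals with a' ≥ n lie in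
that half strip, so they see the projection as they see z^a w^d, namely as zero. The projection is
therefore a finite combination of characters with z-exponent in [0, n), to which `f` is orthogonal
because n ≤ i. -/
lemma intL_mul_star_eq_zero_of_neg {J i : ℤ} (hJ : m ≤ J) (hi : n ≤ i) {f : C(Torus, ℂ)}
    (hf : f ∈ trigSpan e {s | 0 ≤ s.1 ∧ 0 ≤ s.2 ∧ s.2 < J})
    (h0 : ∀ a b : ℤ, 0 ≤ a → a < i → 0 ≤ b → b < J → intL μ (f * star (e a b)) = 0)
    {a d : ℤ} (ha : a < i) (hd : 0 ≤ d) (hdJ : d < J) : intL μ (f * star (e a d)) = 0 := by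
  rcases le_or_gt 0 a with ha0 | ha0
  · exact h0 a d ha0 ha hd hdJ
  have hpi : (2 * Real.pi : ℂ) ^ 2 ≠ 0 := by
    simp [Real.pi_ne_zero]
  have h0' : ∀ a b : ℤ, 0 ≤ a → a < i → 0 ≤ b → b < J →
      inner ℂ (embL2 μ f) (embL2 μ (e a b)) = 0 := by
    intro a b ha ha' hb hb'
    rw [← inner_conj_symm, inner_embL2, h0 a b ha ha' hb hb', map_zero]
  set E := closedTrigSpan e μ {s | 0 ≤ s.1 ∧ 0 ≤ s.2 ∧ s.2 < J} with hE
  have hcomp : CompleteSpace E := Submodule.topologicalClosure.completeSpace _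
  obtain ⟨y, hy, z, hz, hx⟩ := E.exists_add_mem_mem_orthogonal (embL2 μ (e a d))
  have hcoef : ∀ a' d' : ℤ, n ≤ a' → 0 ≤ d' → d' < J →
      inner ℂ (embL2 μ (e a' 0 * dual e n m k q J d')) y = 0 := by
    intro a' d' ha' hd' hdJ'
    have h1 : inner ℂ (embL2 μ (e a' 0 * dual e n m k q J d')) z = 0 :=
      hz _ (embL2_mem (h.shift_dual_mem hJ ha' d'))
    have h2 : inner ℂ (embL2 μ (e a' 0 * dual e n m k q J d')) (embL2 μ (e a d)) = 0 := by
      rw [inner_embL2, h.intL_star_shift_dual _ hd hdJ, if_neg (by omega)]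
    rwa [hx, inner_add_right, h1, add_zero] at h2
  set c : ℤ × ℤ → ℂ := fun s =>
    inner ℂ (embL2 μ (e s.1 0 * dual e n m k q J s.2)) y / (2 * Real.pi : ℂ) ^ 2 with hc
  -- The candidate for the projection: its expansion in the dual coefficients, cut at n where they
  -- vanish.
  set y' : Lp ℂ 2 μ := ∑ s ∈ Finset.Ico (0 : ℤ) n ×ˢ Finset.Ico (0 : ℤ) J,
    c s • embL2 μ (e s.1 s.2) with hy'
  have hy'E : y' ∈ E := by
    refine Submodule.sum_mem _ fun s hs => Submodule.smul_mem _ _ (embL2_mem (mem_trigSpan ?_))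
    rw [Finset.mem_product, Finset.mem_Ico, Finset.mem_Ico] at hs
    exact ⟨hs.1.1, hs.2.1, hs.2.2⟩
  have hyy' : y - y' = 0 := by
    refine h.eq_zero_of_inner_dual (E.sub_mem hy hy'E) fun a' d' ha' hd' hdJ' => ?_
    rw [inner_sub_right, sub_eq_zero, hy', inner_sum]
    have h1 : ∀ s ∈ Finset.Ico (0 : ℤ) n ×ˢ Finset.Ico (0 : ℤ) J,
        inner ℂ (embL2 μ (e a' 0 * dual e n m k q J d')) (c s • embL2 μ (e s.1 s.2)) =
          if s = (a', d') then c (a', d') * (2 * Real.pi : ℂ) ^ 2 else 0 := by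
      intro s hs
      rw [Finset.mem_product, Finset.mem_Ico, Finset.mem_Ico] at hs
      rw [inner_smul_right, inner_embL2, h.intL_star_shift_dual _ hs.2.1 hs.2.2]
      by_cases hs' : s = (a', d')
      · subst hs'
        simp
      · rw [if_neg hs', if_neg (fun h => hs' (Prod.ext h.1 h.2)), mul_zero]
    rw [Finset.sum_congr rfl h1, Finset.sum_ite_eq']
    split_ifs with hmem
    · rw [hc]
      exact (div_mul_cancel₀ _ hpi).symm
    · rw [Finset.mem_product, Finset.mem_Ico, Finset.mem_Ico] at hmem
      exact hcoef _ _ (by by_contra hlt; exact hmem ⟨⟨ha', not_le.mp hlt⟩, hd', hdJ'⟩) hd' hdJ'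
  have h1 : inner ℂ (embL2 μ f) (embL2 μ (e a d)) = 0 := by
    rw [hx, inner_add_right, hz _ (embL2_mem hf), sub_eq_zero.mp hyy', hy', inner_sum, add_zero]
    refine Finset.sum_eq_zero fun s hs => ?_
    rw [Finset.mem_product, Finset.mem_Ico, Finset.mem_Ico] at hs
    rw [inner_smul_right, h0' _ _ hs.1.1 (by omega) hs.2.1 hs.2.2, mul_zero]
  rw [← inner_conj_symm, inner_embL2, map_eq_zero] at h1
  exact h1

lemma norm_char_le (a b : ℤ) : ‖e a b‖ ≤ 1 := by
  have h1 : ‖e a b‖ * ‖e a b‖ = 1 := by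
    rw [← CStarRing.norm_star_mul_self, h.char.star, h.char.mul, neg_add_cancel, neg_add_cancel,
      h.char.one, norm_one]
  nlinarith [norm_nonneg (e a b)]

/-- `f` is orthogonal to z^c w^J q̄: one factor 1/q cancels, and f/q̄ has no w-exponent J. Expanding
q̄, the terms below row J drop out, leaving a recurrence with the coefficients of q(z,0) for the
bounded pairings in row J. -/
lemma intL_mul_star_eq_zero_succ {J i : ℤ} (hJ : m ≤ J)
    (hk : ∀ z : ℂ, ‖z‖ ≤ 1 → ∑ s ∈ Finset.range (n + 1), k (s, 0) * z ^ s ≠ 0)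
    {f : C(Torus, ℂ)} (hf : f ∈ trigSpan e {s | 0 ≤ s.1 ∧ 0 ≤ s.2 ∧ s.2 < J})
    (h0 : ∀ a b : ℤ, a < i → 0 ≤ b → b < J → intL μ (f * star (e a b)) = 0)
    {a : ℤ} (ha : a < i) : intL μ (f * star (e a J)) = 0 := by
  have hrec : ∀ c : ℤ, c < i →
      ∑ s ∈ Finset.range (n + 1), k (s, 0) * intL μ (f * star (e (c - s) J)) = 0 := by
    intro c hc
    have h1 : intL μ (f * star (e c J * star q)) = 0 := by
      have h2 : f * star (e c J * star q) * (r * star r) = f * (e (-c) (-J) * star r) := by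
        rw [star_mul', star_star, h.char.star]
        linear_combination f * e (-c) (-J) * star r * h.mul_inv
      rw [h.intL_eq, h2]
      refine intL_mul_eq_zero_of_mem_trigSpan hf fun a b hs => ?_
      rw [Set.mem_ofPred_eq] at hs
      rw [← mul_assoc, h.char.mul, h.star_inv_coeff (by omega)]
    rw [h.star_eq_sum] at h1
    simp only [Finset.mul_sum, star_sum, map_sum, mul_smul_comm, star_smul, map_smul,
      h.char.mul, smul_eq_mul, RCLike.star_def, RCLike.conj_conj] at h1
    rw [Finset.sum_product] at h1
    rw [← h1]
    refine Finset.sum_congr rfl fun s hs => ?_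
    rw [Finset.sum_eq_single_of_mem 0 (by simp)]
    · simp [sub_eq_add_neg]
    · intro t ht ht0
      rw [Finset.mem_range] at ht
      rw [h0 _ _ (by omega) (by omega) (by omega), mul_zero]
  set Q : Polynomial ℂ := ∑ s ∈ Finset.range (n + 1),
    Polynomial.C (k (s, 0)) * Polynomial.X ^ s with hQ
  -- Indexed downwards from the top exponent i - 1, so that `shift` lowers the z-exponent as the
  -- recurrence does.
  set η : ℕ → ℂ := fun t => intL μ (f * star (e (i - 1 - t) J)) with hη
  have h1 : η = 0 := by
    refine eq_zero_of_aeval_shift (Q := Q) (C := ‖intL μ‖ * ‖f‖) (fun z hz => ?_) (fun t => ?_) ?_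
    · simpa [hQ, Polynomial.eval_finsetSum] using hk z hz
    · refine ((intL μ).le_opNorm _).trans (mul_le_mul_of_nonneg_left ?_ (norm_nonneg _))
      refine (norm_mul_le _ _).trans ?_
      rw [norm_star]
      exact mul_le_of_le_one_right (norm_nonneg _) (h.norm_char_le _ _)
    · ext t
      rw [hQ, map_sum, LinearMap.sum_apply, Finset.sum_apply, Pi.zero_apply,
        ← hrec (i - 1 - t) (by omega)]
      refine Finset.sum_congr rfl fun s _ => ?_
      rw [map_mul, map_pow, Polynomial.aeval_C, Polynomial.aeval_X, Module.End.mul_apply,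
        Module.algebraMap_end_apply, Pi.smul_apply, shift_pow_apply, smul_eq_mul, hη]
      have hts : i - 1 - ((t + s : ℕ) : ℤ) = i - 1 - t - s := by
        push_cast
        ring
      simp only [hts]
  have h2 := congr_fun h1 (i - 1 - a).toNat
  rw [hη, Pi.zero_apply] at h2
  have h3 : i - 1 - ((i - 1 - a).toNat : ℤ) = a := by omega
  simp only [h3] at h2
  exact h2

end IsBernsteinSzego

end Extrapolation

/-! ### Bernstein–Szegő weights satisfy the conditions -/

section BernsteinSzego

variable {μ : Measure Torus} {n m : ℕ} {p : Poly}

lemma emb_injective : Function.Injective emb := by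
  rw [injective_iff_map_eq_zero]
  intro f hf
  have hmem : f ∈ V (f.degreeOf 0 + 1) (f.degreeOf 1 + 1) := mem_V_of_degreeOf_le le_rfl le_rfl
  have hc : ∀ a < f.degreeOf 0 + 1, ∀ b < f.degreeOf 1 + 1, coeffAt f a b = 0 := by
    intro a ha b hb
    have h1 : intL volume (emb f * star (chi a b)) = coeffAt f a b * (2 * Real.pi : ℂ) ^ 2 := by
      conv_lhs => rw [eq_sum_of_mem_V hmem]
      simp only [map_sum, map_smul, emb_mono, Finset.sum_mul, smul_mul_assoc, star_chi, chi_mul,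
        intL_apply, integral_chi]
      rw [Finset.sum_eq_single_of_mem a (Finset.mem_range.mpr ha),
        Finset.sum_eq_single_of_mem b (Finset.mem_range.mpr hb)]
      · simp
      · intro b' _ hb'
        rw [if_neg (by omega), smul_zero]
      · intro a' _ ha'
        refine Finset.sum_eq_zero fun b' _ => ?_
        rw [if_neg (by omega), smul_zero]
    rw [hf, zero_mul, map_zero] at h1
    have hpi : (2 * Real.pi : ℂ) ^ 2 ≠ 0 := by simp [Real.pi_ne_zero]
    exact (mul_eq_zero.mp h1.symm).resolve_right hpi
  rw [eq_sum_of_mem_V hmem]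
  refine Finset.sum_eq_zero fun a ha => Finset.sum_eq_zero fun b hb => ?_
  rw [Finset.mem_range] at ha hb
  rw [hc a ha b hb, zero_smul]

/-- `μ` is the Bernstein–Szegő measure of the polynomial `p` of degree at most `(n, m)`. -/
structure IsWeight (μ : Measure Torus) (n m : ℕ) (p : Poly) : Prop where
  mem : p ∈ V (n + 1) (m + 1)
  stable : IsStable (reverse n m p)
  eq : μ = volume.withDensity (fun x => ENNReal.ofReal (1 / ‖emb p x‖ ^ 2))

lemma IsWeight.emb_reverse_ne_zero (h : IsWeight μ n m p) (x : Torus) :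
    emb (reverse n m p) x ≠ 0 := by
  rw [emb_apply]
  exact h.stable _ _ (norm_circ x.1).le (norm_circ x.2).le

lemma IsWeight.emb_ne_zero (h : IsWeight μ n m p) (x : Torus) : emb p x ≠ 0 := by
  have h1 := h.emb_reverse_ne_zero x
  rw [emb_reverse h.mem, ContinuousMap.mul_apply] at h1
  intro h2
  exact right_ne_zero_of_mul h1 (by simp [h2])

lemma IsWeight.posDefinite (h : IsWeight μ n m p) : PosDefinite μ := by
  intro f hf
  refine mul_pos (by positivity) ?_
  have hne := h.emb_ne_zero
  have hfun : (fun x => ‖onTorus f x‖ ^ 2) = fun x => ‖emb f x‖ ^ 2 := by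
    ext x
    rw [emb_apply]
  rw [hfun, h.eq, integral_withDensity_eq_integral_toReal_smul]
  · have hcont : Continuous fun x =>
        (ENNReal.ofReal (1 / ‖emb p x‖ ^ 2)).toReal • ‖emb f x‖ ^ 2 := by
      have : ∀ x, (ENNReal.ofReal (1 / ‖emb p x‖ ^ 2)).toReal = 1 / ‖emb p x‖ ^ 2 := fun x =>
        ENNReal.toReal_ofReal (by positivity)
      simp only [this]
      exact (continuous_const.div ((emb p).continuous.norm.pow 2) fun x => by
        simpa using hne x).smul ((emb f).continuous.norm.pow 2)
    have hf0 : emb f ≠ 0 := fun h0 => hf (emb_injective (h0.trans (map_zero emb).symm))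
    obtain ⟨x, hx⟩ := DFunLike.ne_iff.mp hf0
    refine hcont.integral_pos_of_hasCompactSupport_nonneg_nonzero
      (HasCompactSupport.of_compactSpace _) (fun x => by positivity) (x := x) ?_
    have h1 : 0 < ‖emb p x‖ := norm_pos_iff.mpr (hne x)
    have h2 : 0 < ‖emb f x‖ := norm_pos_iff.mpr hx
    rw [ENNReal.toReal_ofReal (by positivity)]
    positivity
  · exact (continuous_const.div ((emb p).continuous.norm.pow 2) fun x => by
      simpa using hne x).measurable.ennreal_ofReal
  · exact Filter.Eventually.of_forall fun x => ENNReal.ofReal_lt_top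

/-- The continuous function `1/q` for `q` without zeros on the bicircle. -/
def invFun (q : C(Torus, ℂ)) (hq : ∀ x, q x ≠ 0) : C(Torus, ℂ) :=
  ⟨fun x => (q x)⁻¹, q.continuous.inv₀ hq⟩

variable [IsFiniteMeasure μ]

lemma IsWeight.isBernsteinSzego (h : IsWeight μ n m p) :
    IsBernsteinSzego chi n m (fun s => coeffAt (reverse n m p) s.1 s.2) (emb (reverse n m p))
      (invFun _ h.emb_reverse_ne_zero) μ where
  char := isCharSystem_chi
  eq_sum := by
    conv_lhs => rw [eq_sum_of_mem_V (reverse_mem n m p)]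
    rw [Finset.sum_product]
    simp only [map_sum, map_smul, emb_mono]
  mul_inv := by
    ext x
    exact mul_inv_cancel₀ (h.emb_reverse_ne_zero x)
  inv_coeff a b hab := by
    rw [← (isBiPoly_evalAt (reverse n m p)).integral_eq_zero (h.stable · ·) hab, intL_apply]
    congr 1
    ext x
    rw [ContinuousMap.mul_apply]
    congr 1
    change (emb (reverse n m p) x)⁻¹ = _
    rw [emb_apply]
    rfl
  intL_eq F := by
    rw [intL_apply, integral_withDensity_inv h.emb_ne_zero h.eq, intL_apply]
    congr 1
    ext x
    change _ = F x * ((emb (reverse n m p) x)⁻¹ *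
      starRingEnd ℂ ((emb (reverse n m p) x)⁻¹))
    rw [emb_reverse h.mem, ContinuousMap.mul_apply, ContinuousMap.star_apply, RCLike.star_def,
      map_inv₀, map_mul, Complex.conj_conj, ← mul_inv]
    have h1 : chi n m x * starRingEnd ℂ (chi n m x) = 1 := by
      have := DFunLike.congr_fun (chi_mul n m (-n) (-m)) x
      rwa [← star_chi, add_neg_cancel, add_neg_cancel, chi_zero] at this
    congr 2
    linear_combination -(emb p x * starRingEnd ℂ (emb p x)) * h1

lemma IsBernsteinSzego.symm {e : ℤ → ℤ → C(Torus, ℂ)} {k : ℕ × ℕ → ℂ} {q r : C(Torus, ℂ)}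
    (h : IsBernsteinSzego e n m k q r μ) :
    IsBernsteinSzego (fun a b => e b a) m n (fun s => k s.swap) q r μ where
  char := h.char.symm
  eq_sum := by
    rw [h.eq_sum, Finset.sum_product, Finset.sum_product, Finset.sum_comm]
    rfl
  mul_inv := h.mul_inv
  inv_coeff a b hab := h.inv_coeff b a hab.symm
  intL_eq := h.intL_eq

lemma emb_mem_trigSpan {i j : ℕ} {f : Poly} (hf : f ∈ V i j) :
    emb f ∈ trigSpan chi {s | 0 ≤ s.1 ∧ 0 ≤ s.2 ∧ s.2 < j} := by
  have : V i j ≤ (trigSpan chi {s | 0 ≤ s.1 ∧ 0 ≤ s.2 ∧ s.2 < (j : ℤ)}).comap emb.toLinearMap := by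
    refine Submodule.span_le.mpr ?_
    rintro _ ⟨a, _, b, hb, rfl⟩
    rw [SetLike.mem_coe, Submodule.mem_comap, AlgHom.toLinearMap_apply, emb_mono]
    refine mem_trigSpan ?_
    rw [Set.mem_ofPred_eq]
    omega
  exact this hf

lemma emb_mem_trigSpan_symm {i j : ℕ} {f : Poly} (hf : f ∈ V i j) :
    emb f ∈ trigSpan (fun a b => chi b a) {s | 0 ≤ s.1 ∧ 0 ≤ s.2 ∧ s.2 < i} := by
  have : V i j ≤ (trigSpan (fun a b => chi b a)
      {s | 0 ≤ s.1 ∧ 0 ≤ s.2 ∧ s.2 < (i : ℤ)}).comap emb.toLinearMap := by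
    refine Submodule.span_le.mpr ?_
    rintro _ ⟨a, ha, b, _, rfl⟩
    rw [SetLike.mem_coe, Submodule.mem_comap, AlgHom.toLinearMap_apply, emb_mono]
    refine mem_trigSpan (e := fun a b => chi b a) (a := b) (b := a) ?_
    rw [Set.mem_ofPred_eq]
    omega
  exact this hf

lemma ip_mono_eq_zero_iff {f : Poly} {a b : ℕ} :
    ip μ f (mono a b) = 0 ↔ intL μ (emb f * star (chi a b)) = 0 := by
  rw [ip_eq_intL, emb_mono]
  simp [Real.pi_ne_zero]

lemma Orth.intL_eq_zero {f : Poly} {i j : ℕ} (h : Orth μ f (V i j)) {a b : ℤ} (ha : 0 ≤ a)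
    (hai : a < i) (hb : 0 ≤ b) (hbj : b < j) : intL μ (emb f * star (chi a b)) = 0 := by
  lift a to ℕ using ha
  lift b to ℕ using hb
  exact ip_mono_eq_zero_iff.mp (h _ (mono_mem_V (by omega) (by omega)))

lemma IsWeight.intL_eq_zero_left (h : IsWeight μ n m p) {i j : ℕ} (hi : n ≤ i) (hj : m ≤ j)
    {f : Poly} (hf : f ∈ V (i + 1) j) (hfo : Orth μ f (V i j)) {a b : ℤ} (ha : a < i)
    (hb : 0 ≤ b) (hbj : b < j) : intL μ (emb f * star (chi a b)) = 0 :=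
  h.isBernsteinSzego.intL_mul_star_eq_zero_of_neg (J := j) (i := i) (by exact_mod_cast hj)
    (by exact_mod_cast hi) (emb_mem_trigSpan hf)
    (fun _ _ ha hai hb hbj => hfo.intL_eq_zero ha hai hb hbj) ha hb hbj

lemma IsWeight.intL_eq_zero_right (h : IsWeight μ n m p) {i j : ℕ} (hi : n ≤ i) (hj : m ≤ j)
    {f : Poly} (hf : f ∈ V i (j + 1)) (hfo : Orth μ f (V i j)) {a b : ℤ} (ha : 0 ≤ a)
    (hai : a < i) (hb : b < j) : intL μ (emb f * star (chi a b)) = 0 :=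
  h.isBernsteinSzego.symm.intL_mul_star_eq_zero_of_neg (J := i) (i := j) (by exact_mod_cast hi)
    (by exact_mod_cast hj) (emb_mem_trigSpan_symm hf)
    (fun _ _ hb hbj ha hai => hfo.intL_eq_zero ha hai hb hbj) hb ha hai

lemma evalAt_eq_sum {i j : ℕ} {f : Poly} (hf : f ∈ V i j) (z w : ℂ) :
    evalAt f z w = ∑ a ∈ Finset.range i, ∑ b ∈ Finset.range j, coeffAt f a b * (z ^ a * w ^ b) := by
  conv_lhs => rw [eq_sum_of_mem_V hf]
  simp [evalAt, mono, MvPolynomial.smul_eval]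

lemma IsWeight.kOrth (h : IsWeight μ n m p) {i j : ℕ} (hi : n ≤ i) (hj : m ≤ j) :
    KOrth μ i j := by
  intro f hf hfo
  rw [orth_V]
  intro a ha b hb
  rcases Nat.lt_succ_iff_lt_or_eq.mp hb with hb | rfl
  · exact hfo _ (mono_mem_V ha hb)
  · refine ip_mono_eq_zero_iff.mpr ?_
    refine h.isBernsteinSzego.intL_mul_star_eq_zero_succ (J := b) (i := i) (by exact_mod_cast hj)
      (fun z hz => ?_) (emb_mem_trigSpan hf)
      (fun a c ha hc hcb => h.intL_eq_zero_left hi hj hf hfo ha hc hcb) (by exact_mod_cast ha)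
    -- The recurrence polynomial is the reverse restricted to w = 0, where stability excludes roots
    -- in the closed disk.
    have h1 := h.stable z 0 hz (by simp)
    rw [evalAt_eq_sum (reverse_mem n m p)] at h1
    convert h1 using 2 with s
    rw [Finset.sum_eq_single_of_mem 0 (by simp)]
    · simp
    · intro t _ ht
      simp [ht]

/-- Moving the factor z across lowers the exponent a ≤ i to a - 1 < i; the only new case is the
exponent -1, covered by the extension to negative powers in the strip of height j + 1. -/
lemma IsWeight.eOrth (h : IsWeight μ n m p) {i j : ℕ} (hi : n ≤ i) (hj : m ≤ j) :
    EOrth μ i j := by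
  intro f hf hfo
  rw [orth_V]
  intro a ha b hb
  rw [ip_mono_eq_zero_iff, map_mul emb, emb_X0]
  have h1 : chi 1 0 * emb f * star (chi a b) = emb f * star (chi (a - 1) b) := by
    rw [mul_comm (chi 1 0), mul_assoc, star_chi, star_chi, chi_mul]
    congr 2 <;> ring
  rw [h1]
  exact h.intL_eq_zero_left hi (by omega) hf hfo (by omega) (by omega) (by exact_mod_cast hb)

lemma IsWeight.eOrth' (h : IsWeight μ n m p) {i j : ℕ} (hi : n ≤ i) (hj : m ≤ j) :
    EOrth' μ i j := by
  intro f hf hfo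
  rw [orth_V]
  intro a ha b hb
  rw [ip_mono_eq_zero_iff, map_mul emb, emb_X1]
  have h1 : chi 0 1 * emb f * star (chi a b) = emb f * star (chi a (b - 1)) := by
    rw [mul_comm (chi 0 1), mul_assoc, star_chi, star_chi, chi_mul]
    congr 2 <;> ring
  rw [h1]
  exact h.intL_eq_zero_right (by omega) hj hf hfo (by omega) (by exact_mod_cast ha) (by omega)

end BernsteinSzego

end

end BiCircle

theorem mainTheorem10 (n m : ℕ) (μ : MeasureTheory.Measure BiCircle.Torus)
    [MeasureTheory.IsFiniteMeasure μ] :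
    (μ.AbsolutelyContinuous MeasureTheory.volume ∧
      ∃ p : BiCircle.Poly, BiCircle.HasBidegree n m p ∧
        BiCircle.IsStable (BiCircle.reverse n m p) ∧
        μ = MeasureTheory.volume.withDensity
          (fun x => ENNReal.ofReal (1 / ‖BiCircle.onTorus p x‖ ^ 2))) ↔
    (BiCircle.PosDefinite μ ∧
      ∀ i j : ℕ, n ≤ i → m ≤ j →
        BiCircle.calK μ i j = 0 ∧
        BiCircle.EhatSucc μ i j = 0 ∧
        BiCircle.EhatTildeSucc μ n j = 0) := by
  constructor
  · rintro ⟨-, p, hp, hs, hμ⟩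
    have h : BiCircle.IsWeight μ n m p :=
      ⟨BiCircle.mem_V_of_degreeOf_le hp.1 hp.2.1, hs, by simpa only [BiCircle.emb_apply] using hμ⟩
    have hpos := h.posDefinite
    exact ⟨hpos, fun i j hi hj => ⟨BiCircle.calK_of_KOrth hpos (h.kOrth hi hj),
      BiCircle.EhatSucc_of_EOrth hpos (h.eOrth hi hj),
      BiCircle.EhatTildeSucc_of_EOrth' hpos (h.eOrth' le_rfl hj)⟩⟩
  · rintro ⟨hpos, h⟩
    exact BiCircle.bernsteinSzego_of_orthogonality hpos h
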